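/- Let $n\ge 1$ and $[n]=\{1<\dots<n\}$. **Strings of columns.** A column is a nonempty finite sequence $c=(c^1<\dots<c^k)$ in $[n]$, drawn vertically from top to bottom; $|c|=k$. A string of columns $c_1|_{p_1}c_2|_{p_2}\cdots|_{p_m}c_{m+1}$ is a finite (possibly empty) sequence of columns together with positions $p_r\in\mathbb Z$; in $c|_pc'$ the bottom box of $c'$ stands in row $p$, where rows are counted downwards and the top box of $c$ is in row $1$. Say that $c'$ *fits* $c$ at position $q$ if $1\le q\le |c|+|c'|-1$ (the columns have a common row) and in every common row the entry of $c$ is $\le$ the entry of $c'$. A *Young tableau* is a string of columns with $|c_r|\ge|c_{r+1}|$, $p_r=|c_{r+1}|$, and $c_{r+1}$ fitting $c_r$ at $p_r$ for all $r$; a *quasi-ribbon tableau* is one with $p_r=|c_r|+|c_{r+1}|-1$ and $c_{r+1}$ fitting $c_r$ at $p_r$ for all $r$. The reading $R(w)\in[n]^*$ of a string $w$ reads its columns from left to right, each from bottom to top. **Right-bottom rectification.** Consider the following rewriting rules on two consecutive columns $c|_qc'$ of a string of columns, $|c|=k$, $|c'|=l$, where all other columns of the string stay in place. Let $Q$ be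 the largest position at which $c'$ fits $c$ (if there is one, and $Q=0$ otherwise; at position $0$ the bottom of $c'$ is in the row just above $c^1$). A *cut* of $c|_qc'$ is a pair $(p,m)$ with $0\le p<k$, $1\le m\le l$ such that $c'^m$ is in row $p$ and $c^p\le c'^m<c^{p+1}$ (only $c'^m<c^1$ if $p=0$). *Sliding right* at the cut $(p,m)$ replaces the two columns by $(c^1,\dots,c^p)$, $(c'^1,\dots,c'^m,c^{p+1},\dots,c^k)$, $(c'^{m+1},\dots,c'^l)$, every box staying in its row and empty columns being dropped. * ($\alpha$) If $c'$ fits $c$ at $q$ and $c|_qc'$ has a cut, slide right at the cut with $p$ minimal. * ($\delta^\alpha$) If $c'$ does not fit $c$ at $q$ and $c|_Qc'$ has a cut, move $c'$ to position $Q$ and slide right there at the cut with $p$ minimal. * ($\gamma$) If $q<Q$, and $c'$ fits $c$ at $q$ or ($q<1$ and $c^1\le c'^l$), move $c'$ down to position $Q$. * ($\delta$) If $q\ge k+l$ and $c^k\le c'^1$, move $c'$ up to position $k+l-1$. **Insertions.** $S_r$ and $S_l$ are Schensted's row and column insertions into Young tableaux (row insertion of $x$ bumps the first entry $>x$; column insertion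 bumps the first entry $\ge x$). $H_r$ and $H_l$ are the insertions into quasi-ribbon tableaux, given by their rows: $H_r$ puts $x$ after the last entry $\le x$ of the lowest row having such an entry, the rest of this row becoming a new row just below (if there is no such entry, $x$ becomes a new first row); $H_l$ puts $x$ before the first entry $\ge x$ of the highest row having such an entry, the preceding part of this row staying as a row just above (if there is no such entry, $x$ becomes a new last row). The constructor $C_{H_r}(w)$ (resp. $C_{H_l}(w)$) inserts the letters of $w$ into the empty tableau from left to right by $H_r$ (resp. from right to left by $H_l$). **Quasi-Kashiwara crystal.** For $1\le i<n$ and $w\in[n]^*$, $\ddot f_i(w)=0$ if some $i$ stands to the right of some $i+1$ in $w$ or if $w$ contains no $i$; otherwise $\ddot f_i(w)$ is obtained from $w$ by replacing the rightmost $i$ by $i+1$. The graph $\Gamma(q\mathcal K)$ has vertex set $[n]^*$ and an arrow $u\xrightarrow{i}v$ whenever $\ddot f_i(u)=v\neq 0$; $\Gamma(q\mathcal K,u)$ is the connected component of $u$. A (quasi-)crystal isomorphism between components is a bijection of the vertices that preserves the weight (the number of occurrences of each letter) and such that there is an arrow $v\xrightarrow{i}v'$ if and only if there is an arrow $\psi(v)\xrightarrow{i}\psi(v')$.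 **Statement.** Every Young tableau $d$ has a unique normal form $\mathrm{rba}(d)$ for the rewriting rules, it is a quasi-ribbon tableau, and $\mathrm{rba}$ is a morphism of string data structures, both for $(S_r,H_r)$ and for $(S_l,H_l)$: $\mathrm{rba}(\emptyset)=\emptyset$, and for every Young tableau $d$ and $x\in[n]$, inserting $x$ into $d$ by $S_r$ (resp. $S_l$) and applying $\mathrm{rba}$ gives the same as inserting $x$ into $\mathrm{rba}(d)$ by $H_r$ (resp. $H_l$), and $C_{H_r}(R(d))=C_{H_r}(R(\mathrm{rba}(d)))$ (resp. with $C_{H_l}$). This morphism induces, for every Young tableau $d$, a crystal isomorphism $\Gamma(q\mathcal K,R(d))\to\Gamma(q\mathcal K,R(\mathrm{rba}(d)))$: every vertex of $\Gamma(q\mathcal K,R(d))$ is the reading $R(d')$ of a Young tableau $d'$, and $R(d')\mapsto R(\mathrm{rba}(d'))$ is a crystal isomorphism onto $\Gamma(q\mathcal K,R(\mathrm{rba}(d)))$. -/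

import Mathlib

namespace QuasiCrystal

variable {n : ℕ}

/-! ## Words and the quasi-Kashiwara crystal structure

The alphabet `{1 < ⋯ < n}` is `Fin n` and words are lists of letters. -/

/-- The weight of a word: the number of occurrences of every letter. -/
def wt (w : List (Fin n)) : Fin n → ℕ := fun x => w.count x

open Classical in
/-- The quasi-Kashiwara operator `f̈_i`, for the letters `i` and `i + 1`; the value `none` is the
value `0` of the operator. If some `i` stands to the right of some `i + 1`, or if the word has no
letter `i`, then the value is `0`; otherwise the rightmost `i` is replaced by `i + 1`.
(The operator `ë_i` is its partial inverse, so that the crystal graph is determined by `f̈_i`.) -/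
noncomputable def qf (i : ℕ) (h : i + 1 < n) (w : List (Fin n)) : Option (List (Fin n)) :=
  let lo : Fin n := ⟨i, by omega⟩
  let hi : Fin n := ⟨i + 1, h⟩
  if [hi, lo].Sublist w then none
  else if lo ∈ w then some (w.reverse.replace lo hi).reverse
  else none

/-- The arrow `u → v` labelled by `i` in the crystal graph of the quasi-Kashiwara structure. -/
def Arrow (i : ℕ) (u v : List (Fin n)) : Prop :=
  ∃ h : i + 1 < n, qf i h u = some v

/-- The vertex set of the connected component `Γ(q𝒦, u)` of the word `u`. -/
def component (u : List (Fin n)) : Set (List (Fin n)) :=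
  {v | Relation.EqvGen (fun a b => ∃ i, Arrow i a b) u v}

/-- Isomorphisms of connected components of the quasi-Kashiwara crystal graph: weight-preserving
bijections of the vertices that preserve (and reflect) labelled arrows. -/
structure IsCrystalIso {u u' : List (Fin n)} (ψ : component u → component u') : Prop where
  bijective : Function.Bijective ψ
  wt_eq : ∀ v, wt (ψ v : List (Fin n)) = wt (v : List (Fin n))
  arrow_iff : ∀ (i : ℕ) (v v' : component u),
    Arrow i (v : List (Fin n)) v' ↔ Arrow i (ψ v : List (Fin n)) (ψ v')

/-! ## Strings of columns -/

/-- A (nonempty) column, listed from top to bottom: its entries strictly increase. -/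
def IsColumn (c : List (Fin n)) : Prop := c ≠ [] ∧ c.Pairwise (· < ·)

/-- The data of a string of columns `c₁ |_{p₁} c₂ |_{p₂} ⋯ |_{pₘ} cₘ₊₁`: the list of its columns,
each of them listed from top to bottom, and its gluing sequence. In `c |_p c'` the bottom box of
`c'` stands in row `p`, where the top box of `c` stands in row `1` and rows are counted
downwards. -/
@[ext]
structure ColString (n : ℕ) where
  cols : List (List (Fin n))
  glue : List ℤ

/-- The empty string of columns. -/
def emptyString : ColString n := ⟨[], []⟩

/-- The set of strings of columns. -/
def Scol (n : ℕ) : Set (ColString n) :=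
  {w | (∀ c ∈ w.cols, IsColumn c) ∧ w.glue.length = w.cols.length - 1}

/-- The south-west reading: column by column from left to right, every column from bottom to
top. -/
def readSW (w : ColString n) : List (Fin n) := (w.cols.map List.reverse).flatten

/-- `u |_q v` is row connected and row increasing: the two columns have a common row, and
`u^r ≤ v^s` whenever the `r`-th box of `u` and the `s`-th box of `v` are in the same row. -/
def Fits (u : List (Fin n)) (q : ℤ) (v : List (Fin n)) : Prop :=
  1 ≤ q ∧ q ≤ u.length + v.length - 1 ∧
    ∀ (a b : ℕ) (ha : a < u.length) (hb : b < v.length),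
      (b : ℤ) = a + v.length - q → u[a] ≤ v[b]

/-- The string with the given columns that is glued as a Young tableau: `p_k = |c_{k+1}|`. -/
def topGlued (cs : List (List (Fin n))) : ColString n :=
  ⟨cs, cs.tail.map fun c => (c.length : ℤ)⟩

/-- The string with the given columns that is glued as a quasi-ribbon tableau:
`p_k = |c_k| + |c_{k+1}| - 1`. -/
def ribbonGlued (cs : List (List (Fin n))) : ColString n :=
  ⟨cs, List.zipWith (fun c c' : List (Fin n) => (c.length + c'.length - 1 : ℤ)) cs cs.tail⟩

/-- The set of Young tableaux: top-justified strings of columns of weakly decreasing lengths with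
weakly increasing rows. -/
def Young (n : ℕ) : Set (ColString n) :=
  {w | (∀ c ∈ w.cols, IsColumn c) ∧ w = topGlued w.cols ∧
    w.cols.IsChain fun c c' => c'.length ≤ c.length ∧ Fits c c'.length c'}

/-- The set of quasi-ribbon tableaux: the bottom box of every column stands in the row of the top
box of the next column, and rows weakly increase. -/
def QuasiRibbon (n : ℕ) : Set (ColString n) :=
  {w | (∀ c ∈ w.cols, IsColumn c) ∧ w = ribbonGlued w.cols ∧
    w.cols.IsChain fun c c' => Fits c (c.length + c'.length - 1) c'}

/-! ## The right-bottom rewriting system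

Rules replace two consecutive columns and leave all the other columns of the string in place. To
express this, columns are placed in the plane: a pair `(a, c)` is a column `c` with its top box in
row `a`. A string of columns is a list of placed columns up to vertical translation. -/

/-- The string of columns formed by a list of placed columns. -/
def ofPlaced (P : List (ℤ × List (Fin n))) : ColString n :=
  ⟨P.map Prod.snd,
    List.zipWith (fun x y : ℤ × List (Fin n) => y.1 + y.2.length - x.1) P P.tail⟩

/-- The string `c |_q c'`, with the top box of `c` in row `a`. -/
def pair (a : ℤ) (c : List (Fin n)) (q : ℤ) (c' : List (Fin n)) : List (ℤ × List (Fin n)) :=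
  [(a, c), (a + q - c'.length, c')]

/-- In `u |_q v` the box `u^p` is in the same row as `v^m`, where `m = j + 1`, and
`u^p ≤ v^m < u^{p+1}`. In the case `p = 0` there is no box `u^p`, the box `v^m` is in the row just
above the top of `u`, and the condition is `v^m < u^1`. -/
def IsCut (u : List (Fin n)) (q : ℤ) (v : List (Fin n)) (p j : ℕ) : Prop :=
  (j + 1 : ℤ) = p + v.length - q ∧
    ∃ (hp : p < u.length) (hj : j < v.length),
      (∀ x ∈ u.take p, x ≤ v[j]) ∧ v[j] < u[p]

/-- A cut with `p` minimal. -/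
def IsMinCut (c : List (Fin n)) (q : ℤ) (c' : List (Fin n)) (p j : ℕ) : Prop :=
  IsCut c q c' p j ∧ ∀ p' j', IsCut c q c' p' j' → p ≤ p'

/-- The result of moving, in `c |_q c'`, the boxes of `c` below `c^p` and those of `c'` below
`c'^m`, where `m = j + 1`, one place to the right in their rows. The new columns are
`(c^1; …; c^p)`, `(c'^1; …; c'^m; c^{p+1}; …; c^k)` and `(c'^{m+1}; …; c'^l)`; the empty ones
among them are dropped. -/
def slideRight (a : ℤ) (c : List (Fin n)) (q : ℤ) (c' : List (Fin n)) (p j : ℕ) :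
    List (ℤ × List (Fin n)) :=
  [(a, c.take p),
    (a + q - c'.length, c'.take (j + 1) ++ c.drop p),
    (a + q - c'.length + (j + 1), c'.drop (j + 1))].filter fun x => !x.2.isEmpty

/-- The rules, where `c` has length `k` and `c'` has length `l`. -/
inductive Rule : List (ℤ × List (Fin n)) → List (ℤ × List (Fin n)) → Prop
  /-- Right-sliding `α`: sub-columns are moved to the right. -/
  | alpha (a : ℤ) (c : List (Fin n)) (q : ℤ) (c' : List (Fin n)) (p j : ℕ)
      (hc : IsColumn c) (hc' : IsColumn c') (hq : Fits c q c') (hp : IsMinCut c q c' p j) :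
      Rule (pair a c q c') (slideRight a c q c' p j)
  /-- Right-sliding `δ^α`, for `c |_q c'` not row connected and row increasing: `c'` is moved to
  the lowest position `Q` where it fits, and then sub-columns are moved to the right. If `c'` fits
  nowhere (that is, `c'^l < c^1`), it is put on top of `c` (`Q = 0`) and the two columns merge. -/
  | deltaAlpha (a : ℤ) (c : List (Fin n)) (q Q : ℤ) (c' : List (Fin n)) (p j : ℕ)
      (hc : IsColumn c) (hc' : IsColumn c') (hq : ¬ Fits c q c')
      (hQ : IsGreatest {r : ℤ | r = 0 ∨ Fits c r c'} Q) (hp : IsMinCut c Q c' p j) :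
      Rule (pair a c q c') (slideRight a c Q c' p j)
  /-- Bottom-sliding `γ`: `c'` is moved down to the lowest position `Q` where it fits, if it
  already fits, or if it is above `c` and `c^1 ≤ c'^l`. -/
  | gamma (a : ℤ) (c : List (Fin n)) (q Q : ℤ) (c' : List (Fin n))
      (hc : IsColumn c) (hc' : IsColumn c')
      (hq : Fits c q c' ∨ (q < 1 ∧ c.head hc.1 ≤ c'.getLast hc'.1))
      (hQ : IsGreatest {r : ℤ | Fits c r c'} Q) (hlt : q < Q) :
      Rule (pair a c q c') (pair a c Q c')
  /-- Top-sliding `δ`: if `c'` is below `c`, without a common row, and `c^k ≤ c'^1`, then `c'` is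
  moved up until its top box is in the row of the bottom box of `c`. -/
  | delta (a : ℤ) (c : List (Fin n)) (q : ℤ) (c' : List (Fin n))
      (hc : IsColumn c) (hc' : IsColumn c') (hq : (c.length + c'.length : ℤ) ≤ q)
      (hle : c.getLast hc.1 ≤ c'.head hc'.1) :
      Rule (pair a c q c') (pair a c (c.length + c'.length - 1) c')

/-- Rewriting steps: application of a rule inside a string of columns. -/
def Step (w w' : ColString n) : Prop :=
  w ∈ Scol n ∧ ∃ L u v R, Rule u v ∧ w = ofPlaced (L ++ u ++ R) ∧ w' = ofPlaced (L ++ v ++ R)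

/-- `w'` is a normal form of `w` for the right-bottom rewriting system. -/
def IsNormalFormOf (w w' : ColString n) : Prop :=
  Relation.ReflTransGen Step w w' ∧ ∀ w'', ¬ Step w' w''

open Classical in
/-- The right-bottom rectification: the normal form of `d` (and `d` itself if there is none). -/
noncomputable def rba (d : ColString n) : ColString n :=
  if h : ∃ q, IsNormalFormOf d q then h.choose else d

/-! ## Insertion algorithms -/

/-- Schensted's insertion in a tableau given by its list of rows from top to bottom (resp. of
columns from left to right). If the property `bumped x y` holds for no entry `y` of the first line,
then `x` is put at its end; otherwise `x` replaces the first such `y`, which is inserted in the next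
line. -/
def schensted (bumped : Fin n → Fin n → Bool) : List (List (Fin n)) → Fin n → List (List (Fin n))
  | [], x => [[x]]
  | r :: t, x =>
    match r.find? (bumped x) with
    | none => (r ++ [x]) :: t
    | some y => r.replace y x :: schensted bumped t y

/-- The lines of an array of boxes that is given by its lines in the other direction: for a Young
tableau, its rows from its columns, and its columns from its rows. -/
def transposed (cs : List (List (Fin n))) : List (List (Fin n)) :=
  (List.range ((cs.map List.length).foldr max 0)).map fun i => cs.filterMap fun s => s[i]?

/-- Schensted's right (row) insertion `S_r` in Young tableaux. -/
def insertSr (t : ColString n) (x : Fin n) : ColString n :=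
  topGlued (transposed (schensted (fun x y => decide (x < y)) (transposed t.cols) x))

/-- Schensted's left (column) insertion `S_l` in Young tableaux. -/
def insertSl (t : ColString n) (x : Fin n) : ColString n :=
  topGlued (schensted (fun x y => decide (x ≤ y)) t.cols x)

/-- The columns of a ribbon given by its (nonempty) rows, where the last box of every row stands
just above the first box of the next row; in the same way, the rows of a ribbon from its columns,
where the last box of every column stands just to the left of the first box of the next column. -/
def ribbonTransposed : List (List (Fin n)) → List (List (Fin n))
  | [] => []
  | r :: t =>
    match ribbonTransposed t with
    | [] => r.map fun x => [x]
    | c :: cs => (r.dropLast.map fun x => [x]) ++ (r.getLast?.toList ++ c) :: cs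

/-- Right insertion in a quasi-ribbon tableau given by its rows: in the lowest row with an entry
`y ≤ x`, the letter `x` is put after the last such entry, and what follows in this row becomes a
row of its own. If there is no such row, then `x` is put as a new first row. -/
def insertRowsHr : List (List (Fin n)) → Fin n → List (List (Fin n))
  | [], x => [[x]]
  | r :: t, x =>
    if t.any (fun s => s.any fun y => decide (y ≤ x)) then r :: insertRowsHr t x
    else [r.takeWhile (fun y => decide (y ≤ x)) ++ [x],
      r.dropWhile (fun y => decide (y ≤ x))].filter (fun s => !s.isEmpty) ++ t

/-- Left insertion in a quasi-ribbon tableau given by its rows: in the highest row with an entry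
`x ≤ y`, the letter `x` is put before the first such entry, and what precedes in this row becomes a
row of its own. If there is no such row, then `x` is put as a new last row. -/
def insertRowsHl : List (List (Fin n)) → Fin n → List (List (Fin n))
  | [], x => [[x]]
  | r :: t, x =>
    if r.any (fun y => decide (x ≤ y)) then
      [r.takeWhile (fun y => decide (y < x)),
        x :: r.dropWhile (fun y => decide (y < x))].filter (fun s => !s.isEmpty) ++ t
    else r :: insertRowsHl t x

/-- The right insertion `H_r` in quasi-ribbon tableaux. -/
def insertHr (q : ColString n) (x : Fin n) : ColString n :=
  ribbonGlued (ribbonTransposed (insertRowsHr (ribbonTransposed q.cols) x))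

/-- The left insertion `H_l` in quasi-ribbon tableaux. -/
def insertHl (q : ColString n) (x : Fin n) : ColString n :=
  ribbonGlued (ribbonTransposed (insertRowsHl (ribbonTransposed q.cols) x))

/-! ## Morphisms of string data structures -/

/-- The constructor of a right string data structure with insertion `I`: the letters of a word are
inserted from left to right in the empty string. -/
def constructRight (I : ColString n → Fin n → ColString n) (w : List (Fin n)) : ColString n :=
  w.foldl I emptyString

/-- The constructor of a left string data structure with insertion `I`: the letters of a word are
inserted from right to left in the empty string. -/
def constructLeft (I : ColString n → Fin n → ColString n) (w : List (Fin n)) : ColString n :=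
  w.foldr (fun x d => I d x) emptyString

/-- `f` is a morphism of string data structures from `(D, I, readSW)` to `(D', I', readSW)`, where
`C'` is the constructor (right or left) of the target. -/
structure IsSDSMorphism (D D' : Set (ColString n)) (I I' : ColString n → Fin n → ColString n)
    (C' : List (Fin n) → ColString n) (f : ColString n → ColString n) : Prop where
  mapsTo : Set.MapsTo f D D'
  map_empty : f emptyString = emptyString
  map_insert : ∀ d ∈ D, ∀ x, f (I d x) = I' (f d) x
  map_read : ∀ d ∈ D, C' (readSW d) = C' (readSW (f d))

end QuasiCrystal

namespace QuasiCrystal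

variable {n : ℕ}

/-! ## Inversions and the hypoplactic congruence -/

/-! Everything is governed by one invariant of words, `HypoEquiv`: the content, together with the
information, for letters a < b consecutive in the support, whether some b precedes some a.
Quasi-ribbon tableaux form a cross-section of its classes. The columns, concatenated, are the sorted
word of the content, and a new column starts exactly between two successive letters that are not
inverted (`cols_eq_splitBy`, `quasiRibbon_ext`). Existence in each class comes from rewriting a
string of one-box columns (`exists_quasiRibbon`).

All rewriting rules preserve the class of the reading (`Rule.preserves`), and irreducible strings
are exactly the quasi-ribbon tableaux. Hence normal forms are unique without any confluence
argument, and only the existence of one terminating reduction is needed. That comes from the measure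
"inversions plus number of columns", which drops at every slide (`exists_reduction`). So `rba d` is
the quasi-ribbon tableau in the class of the reading of d.

Schensted bumping in a row or a column also preserves the class, and so do the insertions `H_r` and
`H_l`, which on sorted words merely insert a letter and adjust the cuts next to it. Each identity
required of the morphism thus compares two quasi-ribbon tableaux in the same class.

For the crystals, an arrow keeps all comparisons between positions of a word
(`Arrow.inversionTable_eq`). Being the reading of a Young tableau, or of a quasi-ribbon tableau,
depends only on these comparisons, so both families of readings are stable under arrows. Since the
class also determines which arrows exist, and equivalent words have equivalent targets
(`HypoEquiv.arrow`), passing to the quasi-ribbon tableau commutes with arrows. It is injective on a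
component because content and comparisons determine a word. -/

lemma pair_sublist_cons {α : Type*} {x a b : α} {w : List α} :
    [b, a].Sublist (x :: w) ↔ (b = x ∧ a ∈ w) ∨ [b, a].Sublist w := by
  constructor
  · intro h
    cases h with
    | cons _ h => exact Or.inr h
    | cons_cons _ h => exact Or.inl ⟨rfl, List.singleton_sublist.1 h⟩
  · rintro (⟨rfl, h⟩ | h)
    · exact (List.singleton_sublist.2 h).cons_cons _
    · exact h.cons _

lemma pair_sublist_append {α : Type*} {a b : α} {u v : List α} :
    [b, a].Sublist (u ++ v) ↔
      [b, a].Sublist u ∨ [b, a].Sublist v ∨ (b ∈ u ∧ a ∈ v) := by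
  induction u with
  | nil => simp
  | cons x u ih =>
    simp only [List.cons_append, pair_sublist_cons, ih, List.mem_append, List.mem_cons]
    tauto

lemma pair_sublist_reverse {α : Type*} {a b : α} {w : List α} :
    [b, a].Sublist w.reverse ↔ [a, b].Sublist w := by
  rw [← List.reverse_sublist]; simp

lemma pair_sublist_iff_getElem? {α : Type*} {a b : α} {w : List α} :
    [b, a].Sublist w ↔ ∃ i j : ℕ, i < j ∧ w[i]? = some b ∧ w[j]? = some a := by
  induction w with
  | nil => simp
  | cons x w ih =>
    rw [pair_sublist_cons, ih]
    constructor
    · rintro (⟨rfl, h⟩ | ⟨i, j, hij, hi, hj⟩)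
      · obtain ⟨j, hj⟩ := List.mem_iff_getElem?.1 h
        exact ⟨0, j + 1, by omega, by simp, by simpa using hj⟩
      · exact ⟨i + 1, j + 1, by omega, by simpa using hi, by simpa using hj⟩
    · rintro ⟨i, j, hij, hi, hj⟩
      obtain ⟨j, rfl⟩ : ∃ k, j = k + 1 := ⟨j - 1, by omega⟩
      rw [List.getElem?_cons_succ] at hj
      cases i with
      | zero => exact Or.inl ⟨by simpa using hi.symm, List.mem_of_getElem? hj⟩
      | succ i => exact Or.inr ⟨i, j, by omega, by simpa using hi, hj⟩

lemma pair_sublist_flatten {α : Type*} {a b : α} {L : List (List α)} :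
    [b, a].Sublist L.flatten ↔ (∃ l ∈ L, [b, a].Sublist l) ∨
      ∃ l l', [l, l'].Sublist L ∧ b ∈ l ∧ a ∈ l' := by
  induction L with
  | nil => simp
  | cons l L ih =>
    simp only [List.flatten_cons, pair_sublist_append, ih, List.mem_flatten, pair_sublist_cons,
      List.mem_cons]
    constructor
    · rintro (h | (⟨m, h, h'⟩ | ⟨m, m', h, h', h''⟩) | ⟨h, m, h', h''⟩)
      · exact Or.inl ⟨l, Or.inl rfl, h⟩
      · exact Or.inl ⟨m, Or.inr h, h'⟩
      · exact Or.inr ⟨m, m', Or.inr h, h', h''⟩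
      · exact Or.inr ⟨l, m, Or.inl ⟨rfl, h'⟩, h, h''⟩
    · rintro (⟨m, rfl | h, h'⟩ | ⟨m, m', ⟨rfl, h⟩ | h, h', h''⟩)
      · exact Or.inl h'
      · exact Or.inr (Or.inl (Or.inl ⟨m, h, h'⟩))
      · exact Or.inr (Or.inr ⟨h', m', h, h''⟩)
      · exact Or.inr (Or.inl (Or.inr ⟨m, m', h, h', h''⟩))

/-- Two words are equivalent if they have the same letters and the same inversions between
letters that are consecutive in their common support (the hypoplactic congruence). -/
def HypoEquiv (w w' : List (Fin n)) : Prop :=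
  w.Perm w' ∧ ∀ a b, a < b → (∀ z ∈ w, ¬ (a < z ∧ z < b)) →
    ([b, a].Sublist w ↔ [b, a].Sublist w')

namespace HypoEquiv

lemma refl (w : List (Fin n)) : HypoEquiv w w := ⟨List.Perm.refl _, fun _ _ _ _ => Iff.rfl⟩

lemma symm {w w' : List (Fin n)} (h : HypoEquiv w w') : HypoEquiv w' w :=
  ⟨h.1.symm, fun a b hab hz => (h.2 a b hab fun z hzw => hz z (h.1.mem_iff.1 hzw)).symm⟩

lemma trans {w w' w'' : List (Fin n)} (h : HypoEquiv w w') (h' : HypoEquiv w' w'') :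
    HypoEquiv w w'' :=
  ⟨h.1.trans h'.1, fun a b hab hz => (h.2 a b hab hz).trans
    (h'.2 a b hab fun z hzw => hz z (h.1.mem_iff.2 hzw))⟩

lemma append {u u' v v' : List (Fin n)} (hu : HypoEquiv u u') (hv : HypoEquiv v v') :
    HypoEquiv (u ++ v) (u' ++ v') := by
  refine ⟨hu.1.append hv.1, fun a b hab hz => ?_⟩
  rw [pair_sublist_append, pair_sublist_append,
    hu.2 a b hab fun z h => hz z (List.mem_append_left _ h),
    hv.2 a b hab fun z h => hz z (List.mem_append_right _ h), hu.1.mem_iff, hv.1.mem_iff]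

end HypoEquiv

/-- Right-sliding does not change the class of the reading. -/
lemma hypoEquiv_slide {A B C D : List (Fin n)} {y z : Fin n} (hy : y ∈ B) (hz : z ∈ C)
    (hAz : ∀ x ∈ A, x ≤ z) (hCz : ∀ x ∈ C, x ≤ z) (hzy : z < y)
    (hyB : ∀ x ∈ B, y ≤ x) (hyD : ∀ x ∈ D, y ≤ x) :
    HypoEquiv ((A ++ B).reverse ++ (C ++ D).reverse) (A.reverse ++ ((C ++ B).reverse ++ D.reverse)) := by
  refine ⟨?_, fun a b hab h => ?_⟩
  · simp only [List.reverse_append, List.append_assoc]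
    rw [List.perm_iff_count]
    intro x
    simp only [List.count_append]
    omega
  · simp only [List.mem_append, List.mem_reverse] at h
    simp only [List.reverse_append, pair_sublist_append, List.mem_append, List.mem_reverse]
    -- The slide destroys only the inversions of B with A and of D with C. In both cases a ≤ z < y ≤
    -- b, so consecutiveness forces a = z and b = y. The letter z lies in C and y in B, and the
    -- factor from B precedes the one from C in both readings, so the inversion survives.
    have h1 : b ∈ B → a ∈ A → a ∈ C := by
      intro hb ha
      have := hAz a ha
      have := hyB b hb
      have := h z (by tauto)
      have : a = z := by omega
      exact this ▸ hz
    have h2 : b ∈ D → a ∈ C → b ∈ B := by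
      intro hb ha
      have := hCz a ha
      have := hyD b hb
      have := h y (by tauto)
      have : b = y := by omega
      exact this ▸ hy
    have h3 : b ∈ A → a ∈ B → False := by
      intro hb ha
      have := hAz b hb
      have := hyB a ha
      omega
    have h4 : b ∈ C → a ∈ D → False := by
      intro hb ha
      have := hCz b hb
      have := hyD a ha
      omega
    clear h hAz hCz hyB hyD hy hz
    generalize [b, a].Sublist A.reverse = p₁, [b, a].Sublist B.reverse = p₂,
      [b, a].Sublist C.reverse = p₃, [b, a].Sublist D.reverse = p₄
    grind (splits := 20)

/-- Bumping in a row: the row `A ++ y :: B` receives `x`. -/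
lemma hypoEquiv_bump_row {A B : List (Fin n)} {x y : Fin n} (hA : ∀ a ∈ A, a ≤ x) (hxy : x < y)
    (hB : ∀ b ∈ B, y ≤ b) : HypoEquiv (A ++ y :: B ++ [x]) (y :: (A ++ x :: B)) := by
  refine ⟨?_, fun a b hab h => ?_⟩
  · rw [List.perm_iff_count]
    intro x
    simp only [List.count_append, List.count_cons, List.count_nil]
    omega
  · simp only [List.mem_append, List.mem_cons, List.not_mem_nil, or_false] at h
    have hx := h x (by tauto)
    have hy := h y (by tauto)
    -- The only inversions affected are y with A (created) and B with x (destroyed). Consecutiveness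
    -- reduces both to the pair y, x, which is inverted before and after.
    have h1 : b = y → a ∈ A → a = x := by
      intro hb ha
      have := hA a ha
      omega
    have h2 : a = x → b ∈ B → b = y := by
      intro ha hb
      have := hB b hb
      omega
    have h3 : b ∈ A → a = y → False := by
      intro hb ha
      have := hA b hb
      omega
    have h4 : b = x → a ∈ B → False := by
      intro hb ha
      have := hB a ha
      omega
    have h5 : b = x → a = y → False := by omega
    have h6 : ¬ [b, a].Sublist [x] := fun h => by simpa using h.length_le
    simp only [pair_sublist_append, pair_sublist_cons, List.mem_append, List.mem_cons]
    grind

/-- Bumping in a column: the column `A ++ y :: B` receives `x`. -/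
lemma hypoEquiv_bump_column {A B : List (Fin n)} {x y : Fin n} (hA : ∀ a ∈ A, a < x)
    (hxy : x ≤ y) (hB : ∀ b ∈ B, y < b) :
    HypoEquiv (A ++ y :: B ++ [x]).reverse (y :: (A ++ x :: B)).reverse := by
  refine ⟨?_, fun a b hab h => ?_⟩
  · rw [List.perm_iff_count]
    intro x
    simp only [List.count_reverse, List.count_append, List.count_cons, List.count_nil]
    omega
  · simp only [List.mem_reverse, List.mem_append, List.mem_cons, List.not_mem_nil, or_false] at h
    have hx := h x (by tauto)
    have hy := h y (by tauto)
    -- Here consecutiveness collapses x and y: a < x ≤ y with a, y consecutive gives x = y, and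
    -- likewise x ≤ y < b with x, b consecutive.
    have h1 : b = y → a ∈ A → b = x := by
      intro hb ha
      have := hA a ha
      omega
    have h2 : a = x → b ∈ B → a = y := by
      intro ha hb
      have := hB b hb
      omega
    have h3 : b ∈ A → a = y → False := by
      intro hb ha
      have := hA b hb
      omega
    have h4 : b = x → a ∈ B → False := by
      intro hb ha
      have := hB a ha
      omega
    have h6 : ¬ [a, b].Sublist [x] := fun h => by simpa using h.length_le
    simp only [pair_sublist_reverse, pair_sublist_append, pair_sublist_cons, List.mem_append,
      List.mem_cons]
    grind

/-! ## Standardization -/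

/-- The inversion table of a word, as a record of all comparisons of its letters. -/
def inversionTable : List (Fin n) → List (List Bool)
  | [] => []
  | x :: w => w.map (fun y => decide (y < x)) :: inversionTable w

lemma length_inversionTable (w : List (Fin n)) : (inversionTable w).length = w.length := by
  induction w with
  | nil => rfl
  | cons x w ih => simp [inversionTable, ih]

lemma length_eq_of_inversionTable_eq {w w' : List (Fin n)}
    (h : inversionTable w = inversionTable w') : w.length = w'.length := by
  rw [← length_inversionTable, h, length_inversionTable]

lemma lt_iff_of_inversionTable_eq {w w' : List (Fin n)}
    (h : inversionTable w = inversionTable w') {p q : ℕ} (hpq : p < q) (hq : q < w.length)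
    (hq' : q < w'.length) : w[q] < w[p] ↔ w'[q] < w'[p] := by
  induction w generalizing w' p q with
  | nil => simp at hq
  | cons x w ih =>
    cases w' with
    | nil => simp at hq'
    | cons x' w' =>
      simp only [inversionTable, List.cons.injEq] at h
      obtain ⟨q, rfl⟩ : ∃ k, q = k + 1 := ⟨q - 1, by omega⟩
      simp only [List.length_cons, Nat.add_lt_add_iff_right] at hq hq'
      cases p with
      | zero =>
        have := congrArg (fun l => l[q]?) h.1
        simpa [hq, hq'] using this
      | succ p => simpa using ih h.2 (by omega) hq hq'

/-- This lets a word with the table of a reading be cut into blocks that inherit the tables of the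
single columns. -/
lemma inversionTable_append_inj {u u' v v' : List (Fin n)}
    (h : inversionTable (u ++ v) = inversionTable (u' ++ v')) (hl : u.length = u'.length) :
    inversionTable u = inversionTable u' ∧ inversionTable v = inversionTable v' := by
  induction u generalizing u' with
  | nil =>
    obtain rfl : u' = [] := List.length_eq_zero_iff.1 (by simpa using hl.symm)
    exact ⟨rfl, h⟩
  | cons x u ih =>
    cases u' with
    | nil => simp at hl
    | cons x' u' =>
      simp only [List.cons_append, inversionTable, List.cons.injEq, List.map_append] at h ⊢
      have hl' : u.length = u'.length := by simpa using hl
      have := ih h.2 hl'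
      exact ⟨⟨(List.append_inj h.1 (by simpa using hl')).1, this.1⟩, this.2⟩

/-- The first line of the table counts the letters smaller than the first letter. For a fixed
content, a larger first letter would have strictly more of them, since the smaller candidate would
itself be counted. So the first letter is determined, and the rest follows by recursion. -/
lemma eq_of_inversionTable_eq {w w' : List (Fin n)} (hp : w.Perm w')
    (h : inversionTable w = inversionTable w') : w = w' := by
  induction w generalizing w' with
  | nil => exact (List.nil_perm.1 hp).symm
  | cons x w ih =>
    cases w' with
    | nil => simp at hp
    | cons x' w' =>
      simp only [inversionTable, List.cons.injEq] at h
      have hc : w.countP (fun y => decide (y < x)) = w'.countP (fun y => decide (y < x')) := by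
        have := congrArg (List.countP id) h.1
        simpa [List.countP_map, Function.comp_def] using this
      have key : ∀ {x x' : Fin n} {w w' : List (Fin n)}, (x :: w).Perm (x' :: w') →
          w.countP (fun y => decide (y < x)) = w'.countP (fun y => decide (y < x')) →
          ¬ x < x' := by
        intro x x' w w' hp hc hlt
        have h1 := hp.countP_eq (fun y => decide (y < x'))
        rw [List.countP_cons, List.countP_cons] at h1
        have h2 : w.countP (fun y => decide (y < x)) ≤ w.countP (fun y => decide (y < x')) :=
          List.countP_mono_left (by simp only [decide_eq_true_eq]; intros; omega)
        rw [if_pos (decide_eq_true hlt), if_neg (by simp)] at h1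
        omega
      obtain rfl : x = x' := by
        have h1 := key hp hc
        have h2 := key hp.symm hc.symm
        omega
      rw [ih (List.perm_cons _ |>.1 hp) h.2]

lemma pairwise_gt_of_inversionTable_eq {w w' : List (Fin n)}
    (h : inversionTable w = inversionTable w') (hw : w.Pairwise (· > ·)) :
    w'.Pairwise (· > ·) := by
  have hl := length_eq_of_inversionTable_eq h
  rw [List.pairwise_iff_getElem] at hw ⊢
  intro i j hi hj hij
  exact (lt_iff_of_inversionTable_eq h hij (by omega) hj).1 (hw i j (by omega) (by omega) hij)

/-! ## Arrows of the crystal graph -/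

/-- Uniqueness of the factorization at a first occurrence. It makes an arrow invertible: the changed
letter is the first i + 1 of the target. -/
lemma eq_of_append_cons_eq {α : Type*} {A A' B B' : List α} {x : α} (h : A ++ x :: B = A' ++ x :: B')
    (hA : x ∉ A) (hA' : x ∉ A') : A = A' ∧ B = B' := by
  induction A generalizing A' with
  | nil =>
    cases A' with
    | nil => simpa using h
    | cons y A' => exact absurd (List.mem_cons.2 (Or.inl (List.cons.inj h).1)) hA'
  | cons y A ih =>
    cases A' with
    | nil => exact absurd (List.mem_cons.2 (Or.inl (List.cons.inj h).1.symm)) hA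
    | cons z A' =>
      simp only [List.cons_append, List.cons.injEq, List.mem_cons, not_or] at *
      obtain ⟨rfl, h⟩ := h
      have := ih h hA.2 hA'.2
      exact ⟨⟨rfl, this.1⟩, this.2⟩

lemma exists_last_occurrence {α : Type*} {x : α} {w : List α} (h : x ∈ w) :
    ∃ A B, w = A ++ x :: B ∧ x ∉ B := by
  obtain ⟨A, B, h, hA⟩ := List.eq_append_cons_of_mem (List.mem_reverse.2 h)
  refine ⟨B.reverse, A.reverse, ?_, by simpa using hA⟩
  rw [← List.reverse_inj, h]
  simp

/-- A form symmetric in source and target: the changed letter is the last i of u and the first i + 1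
of v, and the two side conditions together exclude any inversion between i + 1 and i. -/
lemma arrow_iff {i : ℕ} {u v : List (Fin n)} :
    Arrow i u v ↔ ∃ (h : i + 1 < n) (A B : List (Fin n)),
      u = A ++ (⟨i, by omega⟩ : Fin n) :: B ∧ v = A ++ (⟨i + 1, h⟩ : Fin n) :: B ∧
      (⟨i + 1, h⟩ : Fin n) ∉ A ∧ (⟨i, by omega⟩ : Fin n) ∉ B := by
  have key : ∀ (lo hi : Fin n) (A B : List (Fin n)), lo ∉ B →
      ((A ++ lo :: B).reverse.replace lo hi).reverse = A ++ hi :: B := by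
    intro lo hi A B hB
    have : (A ++ lo :: B).reverse = B.reverse ++ lo :: A.reverse := by simp
    rw [this, List.replace_append, List.replace_cons]
    simp [hB]
  refine exists_congr fun h => ?_
  simp only [qf]
  constructor
  · intro hq
    split_ifs at hq with h1 h2
    obtain ⟨A, B, rfl, hB⟩ := exists_last_occurrence h2
    refine ⟨A, B, rfl, ?_, ?_, hB⟩
    · rw [key _ _ _ _ hB] at hq
      exact (Option.some.inj hq).symm
    · intro hA
      exact h1 (by rw [pair_sublist_append]; simp [hA])
  · rintro ⟨A, B, rfl, rfl, hA, hB⟩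
    rw [if_neg, if_pos (by simp), key _ _ _ _ hB]
    rw [pair_sublist_append, pair_sublist_cons]
    rintro (h' | (h' | h') | h')
    · exact hA (h'.subset (by simp))
    · simp at h'
    · exact hB (h'.subset (by simp))
    · exact hA h'.1

lemma Arrow.right_unique {i : ℕ} {u v v' : List (Fin n)} (h : Arrow i u v) (h' : Arrow i u v') :
    v = v' := by
  obtain ⟨_, h⟩ := h
  obtain ⟨_, h'⟩ := h'
  exact Option.some.inj (h.symm.trans h')

lemma Arrow.left_unique {i : ℕ} {u u' v : List (Fin n)} (h : Arrow i u v) (h' : Arrow i u' v) :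
    u = u' := by
  obtain ⟨_, A, B, rfl, rfl, hA, -⟩ := arrow_iff.1 h
  obtain ⟨_, A', B', rfl, he, hA', -⟩ := arrow_iff.1 h'
  obtain ⟨rfl, rfl⟩ := eq_of_append_cons_eq he hA hA'
  rfl

/-- Raising i to i + 1 changes its comparison only with an i to its right or with an i + 1 to its
left, and there are none. -/
lemma Arrow.inversionTable_eq {i : ℕ} {u v : List (Fin n)} (h : Arrow i u v) :
    inversionTable u = inversionTable v := by
  obtain ⟨hi, A, B, rfl, rfl, hA, hB⟩ := arrow_iff.1 h
  clear h
  induction A with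
  | nil =>
    simp only [List.nil_append, inversionTable, List.cons.injEq, and_true]
    refine List.map_congr_left fun y hy => ?_
    have : y ≠ ⟨i, by omega⟩ := fun h => hB (h ▸ hy)
    rw [Ne, Fin.ext_iff] at this
    simp only [Fin.lt_def, decide_eq_decide] at this ⊢
    omega
  | cons a A ih =>
    simp only [List.mem_cons, not_or] at hA
    simp only [List.cons_append, inversionTable, List.cons.injEq, ih hA.2, and_true,
      List.map_append, List.map_cons]
    have := hA.1
    rw [Fin.ext_iff] at this
    simp only [Fin.lt_def] at this ⊢
    congr 2
    rw [decide_eq_decide]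
    omega

/-- The existence of an arrow involves only the content and the inversion of two adjacent letters of
the alphabet, which is information that the class retains. -/
lemma exists_arrow_iff {i : ℕ} {u : List (Fin n)} :
    (∃ v, Arrow i u v) ↔ ∃ h : i + 1 < n,
      ¬ [(⟨i + 1, h⟩ : Fin n), ⟨i, by omega⟩].Sublist u ∧ (⟨i, by omega⟩ : Fin n) ∈ u := by
  constructor
  · rintro ⟨v, h, hv⟩
    refine ⟨h, ?_⟩
    simp only [qf] at hv
    split_ifs at hv with h1 h2
    exact ⟨h1, h2⟩
  · rintro ⟨h, h1, h2⟩
    exact ⟨_, h, by simp only [qf]; rw [if_neg h1, if_pos h2]⟩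

lemma exists_arrow_to_iff {i : ℕ} {v : List (Fin n)} :
    (∃ u, Arrow i u v) ↔ ∃ h : i + 1 < n,
      ¬ [(⟨i + 1, h⟩ : Fin n), ⟨i, by omega⟩].Sublist v ∧ (⟨i + 1, h⟩ : Fin n) ∈ v := by
  constructor
  · rintro ⟨u, h⟩
    obtain ⟨hi, A, B, rfl, rfl, hA, hB⟩ := arrow_iff.1 h
    refine ⟨hi, ?_, by simp⟩
    rw [pair_sublist_append, pair_sublist_cons]
    rintro (h' | (h' | h') | h')
    · exact hA (h'.subset (by simp))
    · exact hB h'.2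
    · exact hB (h'.subset (by simp))
    · exact hA h'.1
  · rintro ⟨h, h1, h2⟩
    obtain ⟨A, B, rfl, hA⟩ := List.eq_append_cons_of_mem h2
    refine ⟨_, arrow_iff.2 ⟨h, A, B, rfl, rfl, hA, fun hB => h1 ?_⟩⟩
    rw [pair_sublist_append, pair_sublist_cons]
    simp [hB]

lemma HypoEquiv.sublist_succ_iff {u u' : List (Fin n)} (hu : HypoEquiv u u') {i : ℕ}
    (h : i + 1 < n) : [(⟨i + 1, h⟩ : Fin n), ⟨i, by omega⟩].Sublist u ↔
      [(⟨i + 1, h⟩ : Fin n), ⟨i, by omega⟩].Sublist u' :=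
  hu.2 _ _ (by simp [Fin.lt_def]) fun z _ hz => by
    simp only [Fin.lt_def] at hz
    omega

lemma HypoEquiv.exists_arrow {u u' v : List (Fin n)} (hu : HypoEquiv u u') {i : ℕ}
    (h : Arrow i u v) : ∃ v', Arrow i u' v' := by
  obtain ⟨hi, h1, h2⟩ := exists_arrow_iff.1 ⟨v, h⟩
  exact exists_arrow_iff.2 ⟨hi, by rwa [← hu.sublist_succ_iff], by rwa [← hu.1.mem_iff]⟩

lemma HypoEquiv.exists_arrow_to {u v v' : List (Fin n)} (hv : HypoEquiv v v') {i : ℕ}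
    (h : Arrow i u v) : ∃ u', Arrow i u' v' := by
  obtain ⟨hi, h1, h2⟩ := exists_arrow_to_iff.1 ⟨u, h⟩
  exact exists_arrow_to_iff.2 ⟨hi, by rwa [← hv.sublist_succ_iff], by rwa [← hv.1.mem_iff]⟩

/-! ## Counting inversions -/

/-- The number of pairs `x ∈ u`, `y ∈ v` with `y < x`. -/
def crossInversions (u v : List (Fin n)) : ℕ := (u.map fun x => v.countP fun y => decide (y < x)).sum

/-- The number of inversions of a word. -/
def inversionCount : List (Fin n) → ℕ
  | [] => 0
  | x :: w => w.countP (fun y => decide (y < x)) + inversionCount w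

lemma inversionCount_append (u v : List (Fin n)) :
    inversionCount (u ++ v) = inversionCount u + inversionCount v + crossInversions u v := by
  induction u with
  | nil => simp [inversionCount, crossInversions]
  | cons x u ih =>
    simp only [List.cons_append, inversionCount, ih, List.countP_append, crossInversions,
      List.map_cons, List.sum_cons]
    omega

lemma crossInversions_perm {u u' v v' : List (Fin n)} (hu : u.Perm u') (hv : v.Perm v') :
    crossInversions u v = crossInversions u' v' := by
  simp only [crossInversions, hv.countP_eq]
  exact (hu.map _).sum_eq

lemma crossInversions_append_left (u u' v : List (Fin n)) :
    crossInversions (u ++ u') v = crossInversions u v + crossInversions u' v := by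
  simp [crossInversions]

lemma crossInversions_append_right (u v v' : List (Fin n)) :
    crossInversions u (v ++ v') = crossInversions u v + crossInversions u v' := by
  simp [crossInversions, List.sum_map_add]

lemma crossInversions_eq_zero {u v : List (Fin n)} (h : ∀ x ∈ u, ∀ y ∈ v, x ≤ y) :
    crossInversions u v = 0 := by
  refine List.sum_eq_zero fun k hk => ?_
  obtain ⟨x, hx, rfl⟩ := List.mem_map.1 hk
  exact List.countP_eq_zero.2 fun y hy => by simpa using h x hx y hy

lemma crossInversions_pos {u v : List (Fin n)} {x y : Fin n} (hx : x ∈ u) (hy : y ∈ v)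
    (h : y < x) : 1 ≤ crossInversions u v := by
  have h1 : 1 ≤ v.countP fun y => decide (y < x) :=
    List.countP_pos_iff.2 ⟨y, hy, by simpa using h⟩
  exact h1.trans (List.le_sum_of_mem (List.mem_map.2 ⟨x, hx, rfl⟩))

/-- The inversions of B with A and of D with C disappear and none are created. A nonempty A or D
loses at least one inversion, which pays for the additional column that it forms after the slide. -/
lemma inversionCount_slide {A B C D : List (Fin n)} {y z : Fin n} (hy : y ∈ B) (hz : z ∈ C)
    (hAB : ∀ x ∈ A, ∀ t ∈ B, x < t) (hCD : ∀ x ∈ C, ∀ t ∈ D, x < t) :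
    inversionCount (A.reverse ++ ((C ++ B).reverse ++ D.reverse)) +
      (if A = [] then 0 else 1) + (if D = [] then 0 else 1) ≤
      inversionCount ((A ++ B).reverse ++ (C ++ D).reverse) := by
  have h1 : crossInversions A.reverse B.reverse = 0 := crossInversions_eq_zero
    fun x hx t ht => (hAB x (List.mem_reverse.1 hx) t (List.mem_reverse.1 ht)).le
  have h2 : crossInversions C.reverse D.reverse = 0 := crossInversions_eq_zero
    fun x hx t ht => (hCD x (List.mem_reverse.1 hx) t (List.mem_reverse.1 ht)).le
  have h3 : (if A = [] then 0 else 1) ≤ crossInversions B.reverse A.reverse := by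
    split_ifs with h
    · exact Nat.zero_le _
    · obtain ⟨x, hx⟩ := List.exists_mem_of_ne_nil A h
      exact crossInversions_pos (List.mem_reverse.2 hy) (List.mem_reverse.2 hx) (hAB x hx y hy)
  have h4 : (if D = [] then 0 else 1) ≤ crossInversions D.reverse C.reverse := by
    split_ifs with h
    · exact Nat.zero_le _
    · obtain ⟨x, hx⟩ := List.exists_mem_of_ne_nil D h
      exact crossInversions_pos (List.mem_reverse.2 hx) (List.mem_reverse.2 hz) (hCD z hz x hx)
  simp only [List.reverse_append, inversionCount_append, crossInversions_append_left,
    crossInversions_append_right]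
  omega

/-! ## Placed columns -/

/-- The reading of a list of placed columns. -/
abbrev readPlaced (P : List (ℤ × List (Fin n))) : List (Fin n) := readSW (ofPlaced P)

lemma readPlaced_append (P P' : List (ℤ × List (Fin n))) :
    readPlaced (P ++ P') = readPlaced P ++ readPlaced P' := by
  simp [readSW, ofPlaced]

lemma readPlaced_cons (x : ℤ × List (Fin n)) (P : List (ℤ × List (Fin n))) :
    readPlaced (x :: P) = x.2.reverse ++ readPlaced P := by
  simp [readSW, ofPlaced]

lemma readPlaced_filter (P : List (ℤ × List (Fin n))) :
    readPlaced (P.filter fun x => !x.2.isEmpty) = readPlaced P := by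
  induction P with
  | nil => rfl
  | cons x P ih =>
    rw [List.filter_cons, readPlaced_cons, ← ih]
    split_ifs with h
    · rw [readPlaced_cons]
    · have : x.2 = [] := by simpa using h
      simp [this]

lemma ofPlaced_mem_Scol {P : List (ℤ × List (Fin n))} :
    ofPlaced P ∈ Scol n ↔ ∀ x ∈ P, IsColumn x.2 := by
  simp only [Scol, ofPlaced, Set.mem_ofPred_eq, List.mem_map, List.length_zipWith, List.length_map,
    List.length_tail]
  constructor
  · exact fun h x hx => h.1 _ ⟨x, hx, rfl⟩
  · refine fun h => ⟨?_, by omega⟩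
    rintro _ ⟨x, hx, rfl⟩
    exact h x hx

lemma exists_placed {w : ColString n} (hw : w ∈ Scol n) :
    ∃ P : List (ℤ × List (Fin n)), w = ofPlaced P ∧ ∀ x ∈ P, IsColumn x.2 := by
  -- The row of the first column is left free, since in the induction it is dictated by the
  -- preceding column.
  have key : ∀ (cs : List (List (Fin n))) (g : List ℤ) (a : ℤ), g.length = cs.length - 1 →
      ∃ P : List (ℤ × List (Fin n)), ofPlaced P = ⟨cs, g⟩ ∧ ∀ x ∈ P.head?, x.1 = a := by
    intro cs
    induction cs with
    | nil => exact fun g a hg => ⟨[], by simp_all [ofPlaced], by simp⟩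
    | cons c cs ih =>
      intro g a hg
      cases cs with
      | nil => exact ⟨[(a, c)], by simp_all [ofPlaced], by simp⟩
      | cons c' cs =>
        cases g with
        | nil => simp at hg
        | cons q g =>
          obtain ⟨P, hP, hP'⟩ := ih g (a + q - c'.length) (by simpa using hg)
          cases P with
          | nil => simp [ofPlaced] at hP
          | cons x P =>
            refine ⟨(a, c) :: x :: P, ?_, by simp⟩
            simp only [List.head?_cons, Option.mem_def, Option.some.injEq, forall_eq'] at hP'
            simp only [ofPlaced, List.map_cons, ColString.mk.injEq, List.cons.injEq,
              List.tail_cons] at hP ⊢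
            refine ⟨⟨trivial, hP.1⟩, ?_⟩
            rw [List.zipWith_cons_cons, hP', hP.2, hP.1.1]
            simp
  obtain ⟨P, hP, -⟩ := key w.cols w.glue 0 hw.2
  have hP : w = ofPlaced P := hP.symm
  exact ⟨P, hP, ofPlaced_mem_Scol.1 (hP ▸ hw)⟩

lemma pair_eq (a b : ℤ) (c c' : List (Fin n)) :
    [(a, c), (b, c')] = pair a c (b + c'.length - a) c' := by
  simp [pair]

/-! ## Effect of the rules -/

lemma IsCut.slide {c c' : List (Fin n)} {q : ℤ} {p j : ℕ} (hc : IsColumn c) (hc' : IsColumn c')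
    (hq : q = 0 ∨ Fits c q c') (h : IsCut c q c' p j) (a : ℤ) :
    (∀ x ∈ slideRight a c q c' p j, IsColumn x.2) ∧
      HypoEquiv (c.reverse ++ c'.reverse) (readPlaced (slideRight a c q c' p j)) ∧
      inversionCount (readPlaced (slideRight a c q c' p j)) + (slideRight a c q c' p j).length <
        inversionCount (c.reverse ++ c'.reverse) + 2 := by
  obtain ⟨hpj, hp, hj, h1, h2⟩ := h
  -- The box of c' below the cut, if any, is in the row of the first moved box of c. At position 0
  -- the cut is at the bottom of c', so there is no such box.
  have h3 : ∀ h : j + 1 < c'.length, (c)[p] ≤ c'[j + 1] := by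
    intro h
    rcases hq with rfl | hq
    · omega
    · exact hq.2.2 p (j + 1) hp h (by push_cast; omega)
  have hAB : ∀ x ∈ c.take p, ∀ t ∈ c.drop p, x < t := by
    have := hc.2
    rw [← List.take_append_drop p c, List.pairwise_append] at this
    exact this.2.2
  have hCD : ∀ x ∈ c'.take (j + 1), ∀ t ∈ c'.drop (j + 1), x < t := by
    have := hc'.2
    rw [← List.take_append_drop (j + 1) c', List.pairwise_append] at this
    exact this.2.2
  have hB : c.drop p = (c)[p] :: c.drop (p + 1) := List.drop_eq_getElem_cons hp
  have hC : c'.take (j + 1) = c'.take j ++ [c'[j]] := List.take_succ_eq_append_getElem hj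
  have hy : (c)[p] ∈ c.drop p := by rw [hB]; exact List.mem_cons_self
  have hz : c'[j] ∈ c'.take (j + 1) := by
    rw [hC]
    exact List.mem_append_right _ (List.mem_singleton.2 rfl)
  have hyB : ∀ x ∈ c.drop p, (c)[p] ≤ x := by
    have := hc.2.sublist (List.drop_sublist p c)
    rw [hB] at this ⊢
    intro x hx
    rcases List.mem_cons.1 hx with rfl | hx
    · exact le_rfl
    · exact ((List.pairwise_cons.1 this).1 x hx).le
  have hCz : ∀ x ∈ c'.take (j + 1), x ≤ c'[j] := by
    have := hc'.2.sublist (List.take_sublist (j + 1) c')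
    rw [hC] at this ⊢
    intro x hx
    rcases List.mem_append.1 hx with hx | hx
    · exact ((List.pairwise_append.1 this).2.2 x hx _ (by simp)).le
    · exact (List.mem_singleton.1 hx).le
  have hyD : ∀ x ∈ c'.drop (j + 1), (c)[p] ≤ x := by
    intro x hx
    have hl : j + 1 < c'.length := by
      by_contra hl
      simp [List.drop_eq_nil_of_le (not_lt.1 hl)] at hx
    have := hc'.2.sublist (List.drop_sublist (j + 1) c')
    rw [List.drop_eq_getElem_cons hl] at this hx
    rcases List.mem_cons.1 hx with rfl | hx
    · exact h3 hl
    · exact (h3 hl).trans ((List.pairwise_cons.1 this).1 x hx).le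
  have hread : readPlaced (slideRight a c q c' p j) =
      (c.take p).reverse ++ ((c'.take (j + 1) ++ c.drop p).reverse ++ (c'.drop (j + 1)).reverse) := by
    rw [slideRight, readPlaced_filter]
    simp [readSW, ofPlaced]
  have hrc : c.reverse ++ c'.reverse = (c.take p ++ c.drop p).reverse ++
      (c'.take (j + 1) ++ c'.drop (j + 1)).reverse := by
    simp only [List.take_append_drop]
  refine ⟨?_, ?_, ?_⟩
  · intro x hx
    obtain ⟨hx, hne⟩ := List.mem_filter.1 hx
    refine ⟨by simpa using hne, ?_⟩
    simp only [List.mem_cons, List.not_mem_nil, or_false] at hx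
    rcases hx with rfl | rfl | rfl
    · exact hc.2.sublist (List.take_sublist _ _)
    · refine List.pairwise_append.2 ⟨hc'.2.sublist (List.take_sublist _ _),
        hc.2.sublist (List.drop_sublist _ _), fun x hx t ht => ?_⟩
      exact (hCz x hx).trans_lt (h2.trans_le (hyB t ht))
    · exact hc'.2.sublist (List.drop_sublist _ _)
  · rw [hread, hrc]
    exact hypoEquiv_slide hy hz h1 hCz h2 hyB hyD
  · have hlen : (slideRight a c q c' p j).length =
        (if c.take p = [] then 0 else 1) + (if c'.drop (j + 1) = [] then 0 else 1) + 1 := by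
      have hM : c'.take (j + 1) ++ c.drop p ≠ [] := by
        rw [hB]
        exact List.append_ne_nil_of_right_ne_nil _ (List.cons_ne_nil _ _)
      simp only [slideRight, List.filter_cons, List.isEmpty_eq_false_iff.2 hM, List.filter_nil]
      by_cases hA : c.take p = [] <;> by_cases hD : c'.drop (j + 1) = [] <;>
        simp only [hA, hD, List.isEmpty_nil, List.isEmpty_eq_false_iff.2, ne_eq,
          not_false_eq_true] <;> simp
    have := inversionCount_slide hy hz hAB hCD
    rw [hread, hrc, hlen]
    omega

lemma Rule.preserves {u v : List (ℤ × List (Fin n))} (h : Rule u v) :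
    (∀ x ∈ v, IsColumn x.2) ∧ HypoEquiv (readPlaced u) (readPlaced v) := by
  have hpair : ∀ (a : ℤ) (c : List (Fin n)) (q : ℤ) (c' : List (Fin n)),
      readPlaced (pair a c q c') = c.reverse ++ c'.reverse := by
    simp [readSW, ofPlaced, pair]
  cases h with
  | alpha a c q c' p j hc hc' hq hp =>
    rw [hpair]
    have := hp.1.slide hc hc' (Or.inr hq) a
    exact ⟨this.1, this.2.1⟩
  | deltaAlpha a c q Q c' p j hc hc' hq hQ hp =>
    rw [hpair]
    have := hp.1.slide hc hc' hQ.1 a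
    exact ⟨this.1, this.2.1⟩
  | gamma a c q Q c' hc hc' hq hQ hlt =>
    rw [hpair, hpair]
    exact ⟨by simp [pair, hc, hc'], HypoEquiv.refl _⟩
  | delta a c q c' hc hc' hq hle =>
    rw [hpair, hpair]
    exact ⟨by simp [pair, hc, hc'], HypoEquiv.refl _⟩

lemma Step.preserves {w w' : ColString n} (h : Step w w') :
    w' ∈ Scol n ∧ HypoEquiv (readSW w) (readSW w') := by
  obtain ⟨hw, L, u, v, R, hr, rfl, rfl⟩ := h
  have := hr.preserves
  rw [ofPlaced_mem_Scol] at hw ⊢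
  simp only [List.mem_append] at hw ⊢
  refine ⟨?_, ?_⟩
  · rintro x ((hx | hx) | hx)
    · exact hw x (by tauto)
    · exact this.1 x hx
    · exact hw x (by tauto)
  · simp only [readPlaced_append]
    exact ((HypoEquiv.refl _).append this.2).append (HypoEquiv.refl _)

lemma preserves_of_reflTransGen {w w' : ColString n} (h : Relation.ReflTransGen Step w w')
    (hw : w ∈ Scol n) : w' ∈ Scol n ∧ HypoEquiv (readSW w) (readSW w') := by
  induction h with
  | refl => exact ⟨hw, HypoEquiv.refl _⟩
  | tail _ h ih => exact ⟨h.preserves.1, ih.2.trans h.preserves.2⟩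

lemma Rule.step {L u v R : List (ℤ × List (Fin n))} (h : Rule u v)
    (hP : ∀ x ∈ L ++ u ++ R, IsColumn x.2) : Step (ofPlaced (L ++ u ++ R)) (ofPlaced (L ++ v ++ R)) :=
  ⟨ofPlaced_mem_Scol.2 hP, L, u, v, R, h, rfl, rfl⟩

/-! ## Applicability of the rules -/

/-- Every entry of the first column is at most every entry of the second one. -/
def LeAll (c c' : List (Fin n)) : Prop := ∀ s ∈ c, ∀ t ∈ c', s ≤ t

lemma LeAll.fits {c c' : List (Fin n)} (h : LeAll c c') {q : ℤ} (h1 : 1 ≤ q)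
    (h2 : q ≤ c.length + c'.length - 1) : Fits c q c' :=
  ⟨h1, h2, fun _ _ _ _ _ => h _ (List.getElem_mem _) _ (List.getElem_mem _)⟩

lemma IsColumn.length_pos {c : List (Fin n)} (hc : IsColumn c) : 1 ≤ c.length :=
  List.length_pos_iff.2 hc.1

lemma IsColumn.getElem_le {c : List (Fin n)} (hc : IsColumn c) {a b : ℕ} (hab : a ≤ b)
    (hb : b < c.length) : (c)[a] ≤ (c)[b] := by
  rcases hab.eq_or_lt with rfl | hab
  · exact le_rfl
  · exact (List.pairwise_iff_getElem.1 hc.2 a b (by omega) hb hab).le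

/-- At position k + l - 1 the single common row contains the largest entry of c and the smallest
entry of c'. -/
lemma leAll_iff_fits {c c' : List (Fin n)} (hc : IsColumn c) (hc' : IsColumn c') :
    LeAll c c' ↔ Fits c (c.length + c'.length - 1) c' := by
  have h1 := hc.length_pos
  have h2 := hc'.length_pos
  refine ⟨fun h => h.fits (by omega) le_rfl, fun h s hs t ht => ?_⟩
  obtain ⟨a, ha, rfl⟩ := List.mem_iff_getElem.1 hs
  obtain ⟨b, hb, rfl⟩ := List.mem_iff_getElem.1 ht
  exact ((hc.getElem_le (Nat.le_sub_one_of_lt ha) (by omega)).trans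
    (h.2.2 (c.length - 1) 0 (by omega) (by omega) (by push_cast [h1]; omega))).trans
    (hc'.getElem_le (Nat.zero_le b) hb)

/-- Such columns fit wherever they have a common row, so the lowest fitting position is the ribbon
position: γ reaches it from above and δ from below. -/
lemma LeAll.rule {c c' : List (Fin n)} (hc : IsColumn c) (hc' : IsColumn c') (h : LeAll c c')
    (a q : ℤ) (hq : q ≠ c.length + c'.length - 1) :
    Rule (pair a c q c') (pair a c (c.length + c'.length - 1) c') := by
  have h1 := hc.length_pos
  have h2 := hc'.length_pos
  by_cases hlt : q < c.length + c'.length - 1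
  · refine Rule.gamma a c q _ c' hc hc' ?_ ⟨(leAll_iff_fits hc hc').1 h, fun r hr => hr.2.1⟩ hlt
    by_cases h0 : q < 1
    · exact Or.inr ⟨h0, h _ (List.head_mem _) _ (List.getLast_mem _)⟩
    · exact Or.inl (h.fits (by omega) hlt.le)
  · exact Rule.delta a c q c' hc hc' (by omega) (h _ (List.getLast_mem _) _ (List.head_mem _))

/-- A cut at the lowest position Q is an obstruction to going one row further down. At Q + 1 some
row has c'[b] < c[a]; at Q the box c'[b] stands one row higher, next to c[a - 1], which is at most
c'[b] (or just above c when a = 0). Failure of `LeAll` guarantees that Q + 1 still has a common row.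
-/
lemma exists_minCut {c c' : List (Fin n)} (hc : IsColumn c) (hc' : IsColumn c')
    (h : ¬ LeAll c c') : ∃ Q p j, IsGreatest {r : ℤ | r = 0 ∨ Fits c r c'} Q ∧
      IsMinCut c Q c' p j := by
  have h1 := hc.length_pos
  have h2 := hc'.length_pos
  obtain ⟨Q, hQ, hmax⟩ := Int.exists_greatest_of_bdd (P := fun r : ℤ => r = 0 ∨ Fits c r c')
    ⟨c.length + c'.length, fun r hr => by
      rcases hr with rfl | hr
      · omega
      · have := hr.2.1
        omega⟩ ⟨0, Or.inl rfl⟩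
  have hcut : ∃ p j, IsCut c Q c' p j := by
    have hQ1 : 0 ≤ Q := hmax 0 (Or.inl rfl)
    have hQ2 : Q < c.length + c'.length - 1 := by
      rcases hQ with rfl | hQ
      · by_contra hlt
        have hl : c.length = 1 ∧ c'.length = 1 := by omega
        omega
      · refine lt_of_le_of_ne hQ.2.1 ?_
        rintro rfl
        exact h ((leAll_iff_fits hc hc').2 hQ)
    have hn : ¬ Fits c (Q + 1) c' := fun hf => by
      have := hmax (Q + 1) (Or.inr hf)
      omega
    simp only [Fits, not_and, not_forall, not_le] at hn
    obtain ⟨a, b, ha, hb, hab, hlt⟩ := hn (by omega) (by omega)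
    refine ⟨a, b, by omega, ha, hb, fun x hx => ?_, hlt⟩
    obtain ⟨i, hi, rfl⟩ := List.mem_iff_getElem.1 hx
    rw [List.length_take] at hi
    rw [List.getElem_take]
    rcases hQ with rfl | hQ
    · omega
    · exact (hc.getElem_le (show i ≤ a - 1 by omega) (by omega)).trans
        (hQ.2.2 (a - 1) b (by omega) hb (by omega))
  classical
  obtain ⟨j, hj⟩ := Nat.find_spec hcut
  exact ⟨Q, Nat.find hcut, j, ⟨hQ, fun r hr => hmax r hr⟩, hj,
    fun p' j' h' => Nat.find_min' hcut ⟨j', h'⟩⟩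

/-- Two columns with a descent between them rewrite in at most two steps to a slide. -/
lemma exists_rule_of_not_leAll {c c' : List (Fin n)} (hc : IsColumn c) (hc' : IsColumn c')
    (h : ¬ LeAll c c') (a q : ℤ) : ∃ u v, (u = pair a c q c' ∨ Rule (pair a c q c') u) ∧
      Rule u v ∧ inversionCount (readPlaced v) + v.length <
        inversionCount (c.reverse ++ c'.reverse) + 2 ∧
      HypoEquiv (c.reverse ++ c'.reverse) (readPlaced v) := by
  obtain ⟨Q, p, j, hQ, hcut⟩ := exists_minCut hc hc' h
  have hs := hcut.1.slide hc hc' hQ.1 a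
  classical
  -- A cut is known only at Q. If c' fits at q, it is first lowered to Q by γ (unless it is there
  -- already) and then α applies; otherwise δ^α does both at once.
  refine ⟨if Fits c q c' then pair a c Q c' else pair a c q c', slideRight a c Q c' p j, ?_, ?_,
    hs.2.2, hs.2.1⟩
  · split_ifs with hf
    · have hle := hQ.2 (Or.inr hf)
      rcases hle.eq_or_lt with rfl | hlt
      · exact Or.inl rfl
      · refine Or.inr (Rule.gamma a c q Q c' hc hc' (Or.inl hf) ⟨?_, fun r hr => ?_⟩ hlt)
        · rcases hQ.1 with h0 | hQ
          · have := hf.1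
            omega
          · exact hQ
        · exact hQ.2 (Or.inr hr)
    · exact Or.inl rfl
  · split_ifs with hf
    · refine Rule.alpha a c Q c' p j hc hc' ?_ hcut
      rcases hQ.1 with h0 | h'
      · have := hQ.2 (Or.inr hf)
        have := hf.1
        omega
      · exact h'
    · exact Rule.deltaAlpha a c q Q c' p j hc hc' hf hQ hcut

/-! ## Normal forms -/

lemma exists_split_of_not_isChain {α : Type*} {r : α → α → Prop} {l : List α}
    (h : ¬ l.IsChain r) : ∃ L x y R, l = L ++ [x, y] ++ R ∧ ¬ r x y := by
  induction l with
  | nil => simp at h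
  | cons x l ih =>
    cases l with
    | nil => simp at h
    | cons y l =>
      by_cases hxy : r x y
      · obtain ⟨L, x', y', R, hl, h'⟩ := ih fun hl => h (List.isChain_cons_cons.2 ⟨hxy, hl⟩)
        exact ⟨x :: L, x', y', R, by simp [hl], h'⟩
      · exact ⟨[], x, y, l, by simp, hxy⟩

lemma isChain_pair {α : Type*} {r : α → α → Prop} {L R : List α} {x y : α}
    (h : (L ++ [x, y] ++ R).IsChain r) : r x y := by
  rw [List.append_assoc] at h
  have := (List.isChain_append.1 h).2.1
  simp only [List.cons_append, List.isChain_cons_cons] at this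
  exact this.1

/-- The gluing of consecutive columns in a ribbon. -/
def RibbonGlue (x y : ℤ × List (Fin n)) : Prop :=
  y.1 + y.2.length - x.1 = x.2.length + y.2.length - 1

lemma ofPlaced_eq_ribbonGlued_iff {P : List (ℤ × List (Fin n))} :
    ofPlaced P = ribbonGlued (P.map Prod.snd) ↔ P.IsChain RibbonGlue := by
  simp only [ofPlaced, ribbonGlued, ColString.mk.injEq, true_and]
  induction P with
  | nil => simp
  | cons x P ih =>
    cases P with
    | nil => simp
    | cons y P =>
      rw [List.isChain_cons_cons, ← ih]
      simp [RibbonGlue]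

lemma isChain_congr_of_mem {α : Type*} {r s : α → α → Prop} {l : List α}
    (h : ∀ x ∈ l, ∀ y ∈ l, r x y ↔ s x y) : l.IsChain r ↔ l.IsChain s := by
  induction l with
  | nil => simp
  | cons x l ih =>
    cases l with
    | nil => simp
    | cons y l =>
      rw [List.isChain_cons_cons, List.isChain_cons_cons, h x (by simp) y (by simp),
        ih fun a ha b hb => h a (List.mem_cons_of_mem _ ha) b (List.mem_cons_of_mem _ hb)]

lemma mem_quasiRibbon_iff {q : ColString n} : q ∈ QuasiRibbon n ↔
    (∀ c ∈ q.cols, IsColumn c) ∧ q = ribbonGlued q.cols ∧ q.cols.IsChain LeAll := by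
  simp only [QuasiRibbon, Set.mem_ofPred_eq]
  refine and_congr_right fun h => and_congr_right fun _ => ?_
  exact isChain_congr_of_mem fun x hx y hy => (leAll_iff_fits (h x hx) (h y hy)).symm

lemma ofPlaced_mem_quasiRibbon {P : List (ℤ × List (Fin n))} (hP : ∀ x ∈ P, IsColumn x.2)
    (h : P.IsChain fun x y => LeAll x.2 y.2) (h' : P.IsChain RibbonGlue) :
    ofPlaced P ∈ QuasiRibbon n := by
  refine mem_quasiRibbon_iff.2 ⟨fun c hc => ?_, ofPlaced_eq_ribbonGlued_iff.2 h', ?_⟩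
  · obtain ⟨x, hx, rfl⟩ := List.mem_map.1 hc
    exact hP x hx
  · exact (List.isChain_map _).2 h

/-- A string of columns to which no rule applies is a quasi-ribbon tableau. -/
lemma mem_quasiRibbon_of_irreducible {w : ColString n} (hw : w ∈ Scol n)
    (h : ∀ w', ¬ Step w w') : w ∈ QuasiRibbon n := by
  obtain ⟨P, rfl, hP⟩ := exists_placed hw
  have hle : P.IsChain fun x y => LeAll x.2 y.2 := by
    by_contra hc
    obtain ⟨L, x, y, R, rfl, hxy⟩ := exists_split_of_not_isChain hc
    rw [show [x, y] = pair x.1 x.2 (y.1 + y.2.length - x.1) y.2 from pair_eq ..] at hP h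
    obtain ⟨u, v, rfl | hu, hv, -⟩ := exists_rule_of_not_leAll (hP x (by simp [pair]))
      (hP (x.1 + (y.1 + y.2.length - x.1) - y.2.length, y.2) (by simp [pair])) hxy x.1
        (y.1 + y.2.length - x.1)
    · exact h _ (hv.step hP)
    · exact h _ (hu.step hP)
  refine ofPlaced_mem_quasiRibbon hP hle ?_
  by_contra hc
  obtain ⟨L, x, y, R, rfl, hxy⟩ := exists_split_of_not_isChain hc
  have hle' : LeAll x.2 y.2 := isChain_pair (r := fun x y : ℤ × List (Fin n) => LeAll x.2 y.2) hle
  have hr := hle'.rule (hP x (by simp)) (hP y (by simp)) x.1 _ hxy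
  rw [← pair_eq] at hr
  exact h _ (hr.step hP)

/-- No rule applies to a quasi-ribbon tableau. -/
lemma irreducible_of_mem_quasiRibbon {q : ColString n} (hq : q ∈ QuasiRibbon n) (w : ColString n) :
    ¬ Step q w := by
  rintro ⟨-, L, u, v, R, hr, rfl, -⟩
  rw [mem_quasiRibbon_iff] at hq
  have hG := ofPlaced_eq_ribbonGlued_iff.1 hq.2.1
  -- At the ribbon position no lower position has a common row, which excludes γ and δ. A cut there
  -- would need p ≥ k, which excludes α. Since the columns fit, δ^α is excluded too.
  have key : ∀ (a : ℤ) (c : List (Fin n)) (r : ℤ) (c' : List (Fin n)), u = pair a c r c' →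
      IsColumn c → IsColumn c' → r = c.length + c'.length - 1 ∧ Fits c r c' := by
    rintro a c r c' rfl hc hc'
    have h1 := isChain_pair hG
    simp only [RibbonGlue] at h1
    have h2 := isChain_pair ((List.isChain_map _).1 hq.2.2)
    have h3 : r = c.length + c'.length - 1 := by omega
    exact ⟨h3, h3 ▸ (leAll_iff_fits hc hc').1 h2⟩
  cases hr with
  | alpha a c q c' p j hc hc' hq hp =>
    have := (key a c q c' rfl hc hc').1
    obtain ⟨⟨h1, h2, -⟩, -⟩ := hp
    omega
  | deltaAlpha a c q Q c' p j hc hc' hf hQ hp => exact hf (key a c q c' rfl hc hc').2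
  | gamma a c q Q c' hc hc' hq hQ hlt =>
    have := (key a c q c' rfl hc hc').1
    have := hQ.1.2.1
    omega
  | delta a c q c' hc hc' hq hle =>
    have := (key a c q c' rfl hc hc').1
    omega

/-- Columns are brought to the ribbon position from left to right. Moving one of them leaves those
to its right in their rows and only changes the next gluing, which is treated afterwards. The prefix
`L` holds what is already treated. -/
lemma exists_reduction_of_leAll (P L : List (ℤ × List (Fin n))) (x : ℤ × List (Fin n))
    (hP : ∀ y ∈ L ++ x :: P, IsColumn y.2) (h : (x :: P).IsChain fun x y => LeAll x.2 y.2) :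
    ∃ P' : List (ℤ × List (Fin n)), P'.map Prod.snd = P.map Prod.snd ∧
      (x :: P').IsChain RibbonGlue ∧
      Relation.ReflTransGen Step (ofPlaced (L ++ x :: P)) (ofPlaced (L ++ x :: P')) := by
  induction P generalizing L x with
  | nil => exact ⟨[], rfl, by simp, Relation.ReflTransGen.refl⟩
  | cons y P ih =>
    rw [List.isChain_cons_cons] at h
    set y' : ℤ × List (Fin n) := (x.1 + (x.2.length + y.2.length - 1) - y.2.length, y.2) with hy'
    have hP' : ∀ z ∈ (L ++ [x]) ++ y' :: P, IsColumn z.2 := by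
      intro z hz
      simp only [List.append_assoc, List.mem_append, List.mem_cons, List.singleton_append] at hz hP
      rcases hz with hz | rfl | rfl | hz
      · exact hP z (by tauto)
      · exact hP z (by tauto)
      · exact hP y (by tauto)
      · exact hP z (by tauto)
    obtain ⟨P', h1, h2, h3⟩ := ih (L ++ [x]) y' hP' (by
      cases P with
      | nil => simp
      | cons z P => simpa using h.2)
    refine ⟨y' :: P', by simp [h1, hy'], List.isChain_cons_cons.2 ⟨by simp [RibbonGlue, hy'], h2⟩, ?_⟩
    have hstep : Relation.ReflTransGen Step (ofPlaced (L ++ x :: y :: P))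
        (ofPlaced (L ++ [x] ++ y' :: P)) := by
      by_cases hg : RibbonGlue x y
      · have : y' = y := by
          simp only [RibbonGlue] at hg
          ext1
          · simp only [hy']
            omega
          · rfl
        rw [this]
        simpa using Relation.ReflTransGen.refl
      · have hr := h.1.rule (hP x (by simp)) (hP y (by simp)) x.1 _ hg
        rw [← pair_eq] at hr
        have := hr.step (L := L) (R := P) (by simpa using hP)
        simpa [pair, hy'] using Relation.ReflTransGen.single this
    simpa using hstep.trans h3

/-- Induction on inversions plus number of columns: every descent between neighbouring columns
allows a slide that lowers this number, and once there are no descents only the gluing remains. This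
is one chosen reduction; termination of all of them is not needed. -/
lemma exists_reduction {w : ColString n} (hw : w ∈ Scol n) :
    ∃ q ∈ QuasiRibbon n, Relation.ReflTransGen Step w q := by
  obtain ⟨P, rfl, hP⟩ := exists_placed hw
  clear hw
  generalize hN : inversionCount (readPlaced P) + P.length = N
  induction N using Nat.strong_induction_on generalizing P with
  | _ N ih =>
    by_cases hle : P.IsChain fun x y => LeAll x.2 y.2
    · cases P with
      | nil => exact ⟨_, ofPlaced_mem_quasiRibbon (by simp) (by simp) (by simp),
          Relation.ReflTransGen.refl⟩
      | cons x P =>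
        obtain ⟨P', h1, h2, h3⟩ := exists_reduction_of_leAll P [] x (by simpa using hP) hle
        refine ⟨_, ofPlaced_mem_quasiRibbon ?_ ?_ h2, h3⟩
        · exact ofPlaced_mem_Scol.1 (preserves_of_reflTransGen h3 (ofPlaced_mem_Scol.2 hP)).1
        · rw [← List.isChain_map (R := LeAll) Prod.snd] at hle ⊢
          rwa [List.map_cons, h1, ← List.map_cons]
    · obtain ⟨L, x, y, R, rfl, hxy⟩ := exists_split_of_not_isChain hle
      obtain ⟨u, v, hu, hv, hlt, heq⟩ := exists_rule_of_not_leAll (hP x (by simp))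
        (hP y (by simp)) hxy x.1 (y.1 + y.2.length - x.1)
      rw [← pair_eq] at hu
      have h1 : Relation.ReflTransGen Step (ofPlaced (L ++ [x, y] ++ R)) (ofPlaced (L ++ u ++ R)) := by
        rcases hu with rfl | hu
        · exact Relation.ReflTransGen.refl
        · exact Relation.ReflTransGen.single (hu.step hP)
      have hu' := ofPlaced_mem_Scol.1 (preserves_of_reflTransGen h1 (ofPlaced_mem_Scol.2 hP)).1
      have h2 := h1.tail (hv.step hu')
      have hv' := ofPlaced_mem_Scol.1 (preserves_of_reflTransGen h2 (ofPlaced_mem_Scol.2 hP)).1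
      have hread : readPlaced [x, y] = x.2.reverse ++ y.2.reverse := by simp [readSW, ofPlaced]
      obtain ⟨q, hq, h3⟩ := ih _ (by
        rw [← hN]
        simp only [readPlaced_append, inversionCount_append, crossInversions_append_left, hread,
          List.length_append, List.length_cons, List.length_nil] at hlt ⊢
        -- The slide permutes the letters of the two columns, so inversions with the letters outside
        -- them are as many as before.
        have e1 : crossInversions (readPlaced L) (readPlaced v) =
            crossInversions (readPlaced L) (x.2.reverse ++ y.2.reverse) :=
          crossInversions_perm (List.Perm.refl _) heq.1.symm
        have e2 : crossInversions (readPlaced v) (readPlaced R) =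
            crossInversions (x.2.reverse ++ y.2.reverse) (readPlaced R) :=
          crossInversions_perm heq.1.symm (List.Perm.refl _)
        rw [crossInversions_append_left] at e2
        omega) (L ++ v ++ R) hv' rfl
      exact ⟨q, hq, h2.trans h3⟩

/-! ## Splitting a sorted word into the lines of a ribbon -/

/-- The recursion at the head of the list, on which the later inductions over ribbon lines rely. -/
lemma splitBy_cons_cons {α : Type*} {r : α → α → Bool} {x y : α} {s h : List α} {t : List (List α)}
    (hs : (y :: s).splitBy r = h :: t) :
    (x :: y :: s).splitBy r = if r x y then (x :: h) :: t else [x] :: h :: t := by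
  split_ifs with hxy
  · rw [List.splitBy_eq_iff] at hs ⊢
    obtain ⟨h1, h2, h3, h4⟩ := hs
    cases h with
    | nil => simp at h2
    | cons z h =>
      obtain ⟨rfl, h1⟩ : y = z ∧ s = h ++ t.flatten := by simpa using h1
      refine ⟨by simp [h1], by simp_all, ?_, ?_⟩
      · intro m hm
        rcases List.mem_cons.1 hm with rfl | hm
        · exact List.isChain_cons_cons.2 ⟨hxy, h3 _ (by simp)⟩
        · exact h3 m (List.mem_cons_of_mem _ hm)
      · cases t with
        | nil => simp
        | cons t₀ t =>
          rw [List.isChain_cons_cons] at h4 ⊢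
          refine ⟨?_, h4.2⟩
          obtain ⟨ha, hb, h5⟩ := h4.1
          exact ⟨by simp, hb, by simpa using h5⟩
  · have := List.splitBy_append_cons (r := r) (l := [x]) (a := y) s (by simpa using hxy)
    rw [List.singleton_append] at this
    rw [this, hs]
    rfl

lemma exists_splitBy_cons {α : Type*} (r : α → α → Bool) (x : α) (s : List α) :
    ∃ h t, (x :: s).splitBy r = (x :: h) :: t ∧ s = h ++ t.flatten := by
  have h := List.flatten_splitBy r (x :: s)
  have h' := List.nil_notMem_splitBy r (x :: s)
  match hs : (x :: s).splitBy r with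
  | [] => simp [hs] at h
  | [] :: t => simp [hs] at h'
  | (y :: l) :: t =>
    rw [hs] at h
    obtain ⟨rfl, h₁⟩ : y = x ∧ l ++ t.flatten = s := by simpa using h
    exact ⟨l, t, rfl, h₁.symm⟩

lemma splitBy_congr {α : Type*} {r r' : α → α → Bool} {s : List α}
    (h : s.IsChain fun x y => r' x y = r x y) : s.splitBy r' = s.splitBy r := by
  induction s with
  | nil => rfl
  | cons x s ih =>
    cases s with
    | nil => rfl
    | cons y s =>
      rw [List.isChain_cons_cons] at h
      obtain ⟨l, t, hl, -⟩ := exists_splitBy_cons r y s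
      rw [splitBy_cons_cons hl, splitBy_cons_cons ((ih h.2).trans hl), h.1]

/-- Passing from the columns of a ribbon to its rows exchanges the two kinds of consecutive
boxes. -/
lemma ribbonTransposed_splitBy (r : Fin n → Fin n → Bool) (s : List (Fin n)) :
    ribbonTransposed (s.splitBy r) = s.splitBy fun x y => !r x y := by
  induction s with
  | nil => rfl
  | cons x s ih =>
    cases s with
    | nil => rfl
    | cons y s =>
      obtain ⟨l, t, hl, -⟩ := exists_splitBy_cons r y s
      obtain ⟨l', t', hl', -⟩ := exists_splitBy_cons (fun x y => !r x y) y s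
      rw [splitBy_cons_cons hl, splitBy_cons_cons hl']
      rw [hl, hl'] at ih
      cases hxy : r x y
      · simp only [Bool.false_eq_true, if_false, Bool.not_false, if_true]
        rw [ribbonTransposed, ih]
        rfl
      · simp only [if_true, ribbonTransposed, Bool.not_true] at ih ⊢
        cases ht : ribbonTransposed t with
        | nil => simpa [ht] using ih
        | cons c cs => simpa [ht, List.getLast?_cons_cons] using ih

/-- Rows of a ribbon are a sorted word cut where `r` fails. In these terms `H_r` places x between
the letters ≤ x and those > x, joins it to the former and cuts before the latter; `r'` is any
relation recording this. The row of insertion is the one containing the last letter of A. -/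
lemma insertRowsHr_splitBy {r r' : Fin n → Fin n → Bool} {x : Fin n} {A B : List (Fin n)}
    (hA : ∀ a ∈ A, a ≤ x) (hB : ∀ b ∈ B, x < b) (hA' : A.IsChain fun u v => r' u v = r u v)
    (hB' : B.IsChain fun u v => r' u v = r u v) (hx : ∀ a ∈ A.getLast?, r' a x = true)
    (hx' : ∀ b ∈ B.head?, r' x b = false) :
    insertRowsHr ((A ++ B).splitBy r) x = (A ++ x :: B).splitBy r' := by
  have hany : ∀ {s : List (List (Fin n))}, s.flatten = B →
      s.any (fun s => s.any fun y => decide (y ≤ x)) = false := by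
    intro s hs
    simp only [List.any_eq_false, List.any_eq_true, decide_eq_true_eq, not_exists, not_and, not_le]
    exact fun l hl y hy => hB y (hs ▸ List.mem_flatten.2 ⟨l, hl, hy⟩)
  have hBx : (x :: B).splitBy r' = [x] :: B.splitBy r := by
    have := List.splitBy_append (r := r') (l := [x]) (m := B) (by simpa using hx')
    rw [List.singleton_append] at this
    rw [this, splitBy_congr hB']
    rfl
  induction A with
  | nil =>
    rw [List.nil_append, List.nil_append, hBx]
    cases B with
    | nil => rfl
    | cons b B =>
      obtain ⟨l, t, hl, ht⟩ := exists_splitBy_cons r b B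
      rw [hl, insertRowsHr]
      have hb := hB b (by simp)
      have : t.any (fun s => s.any fun y => decide (y ≤ x)) = false := by
        have := hany (s := (b :: l) :: t) (by simp [ht])
        rw [List.any_cons, Bool.or_eq_false_iff] at this
        exact this.2
      simp [this, hb]
  | cons y A ih =>
    have hy := hA y (by simp)
    cases A with
    | nil =>
      obtain ⟨l, t, hl, -⟩ := exists_splitBy_cons r' x B
      have hyx : r' y x = true := hx y (by simp)
      have e : (y :: x :: B).splitBy r' = [y, x] :: B.splitBy r := by
        rw [splitBy_cons_cons hBx, if_pos hyx]
      rw [List.cons_append, List.cons_append, List.nil_append, List.nil_append, e]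
      cases B with
      | nil =>
        change insertRowsHr [[y]] x = [[y, x]]
        simp [insertRowsHr, hy]
      | cons b B =>
        obtain ⟨l, t, hl, ht⟩ := exists_splitBy_cons r b B
        have hb := hB b (by simp)
        have h0 := hany (s := (b :: l) :: t) (by simp [ht])
        have h1 := h0
        rw [List.any_cons, Bool.or_eq_false_iff] at h1
        rw [splitBy_cons_cons hl, hl]
        have hl' : ∀ z ∈ l, x < z := fun z hz => hB z (by simp [ht, hz])
        cases r y b
        · simp [insertRowsHr, hy, h1.2, hb]
          simpa using hl'
        · simp [insertRowsHr, hy, h1.2, hb]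
    | cons z A =>
      rw [List.isChain_cons_cons] at hA'
      have ih := ih (fun a ha => hA a (List.mem_cons_of_mem _ ha)) hA'.2
        (fun a ha => hx a (by simpa using ha))
      have hz := hA z (by simp)
      obtain ⟨l, t, hl, -⟩ := exists_splitBy_cons r z (A ++ B)
      obtain ⟨l', t', hl', -⟩ := exists_splitBy_cons r' z (A ++ x :: B)
      simp only [List.cons_append] at ih ⊢
      rw [splitBy_cons_cons hl, splitBy_cons_cons hl', hA'.1]
      rw [hl, hl'] at ih
      cases r y z
      · simp only [Bool.false_eq_true, if_false]
        rw [insertRowsHr, if_pos (by simp [hz]), ih]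
      · simp only [if_true]
        rw [insertRowsHr] at ih ⊢
        split_ifs at ih ⊢ with h
        · simp only [List.cons.injEq, true_and] at ih ⊢
          exact ih
        · simp [hy, hz] at ih ⊢
          exact ih

/-- The mirror image: x is joined to the letters ≥ x and the cut is made before x. -/
lemma insertRowsHl_splitBy {r r' : Fin n → Fin n → Bool} {x : Fin n} {A B : List (Fin n)}
    (hA : ∀ a ∈ A, a < x) (hB : ∀ b ∈ B, x ≤ b) (hA' : A.IsChain fun u v => r' u v = r u v)
    (hB' : B.IsChain fun u v => r' u v = r u v) (hx : ∀ a ∈ A.getLast?, r' a x = false)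
    (hx' : ∀ b ∈ B.head?, r' x b = true) :
    insertRowsHl ((A ++ B).splitBy r) x = (A ++ x :: B).splitBy r' := by
  induction A with
  | nil =>
    rw [List.nil_append, List.nil_append]
    cases B with
    | nil => rfl
    | cons b B =>
      obtain ⟨l, t, hl, ht⟩ := exists_splitBy_cons r b B
      have hb := hB b (by simp)
      rw [splitBy_cons_cons ((splitBy_congr hB').trans hl), if_pos (hx' b (by simp)), hl]
      simp [insertRowsHl, hb, not_lt.2 hb]
  | cons y A ih =>
    have hy := hA y (by simp)
    have ih := ih (fun a ha => hA a (List.mem_cons_of_mem _ ha)) hA'.tail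
    cases A with
    | nil =>
      have hyx : r' y x = false := hx y (by simp)
      have ih := ih (by simp)
      obtain ⟨l, t, hl, -⟩ := exists_splitBy_cons r' x B
      rw [List.nil_append, List.nil_append] at ih
      rw [List.cons_append, List.cons_append, List.nil_append, List.nil_append,
        splitBy_cons_cons hl, if_neg (by simp [hyx]), ← hl, ← ih]
      cases B with
      | nil =>
        change insertRowsHl [[y]] x = [y] :: insertRowsHl [] x
        simp [insertRowsHl, hy]
      | cons b B =>
        obtain ⟨l, t, hl, ht⟩ := exists_splitBy_cons r b B
        have hb := hB b (by simp)
        rw [splitBy_cons_cons hl, hl]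
        cases r y b <;> simp [insertRowsHl, hy, hb, not_lt.2 hb]
    | cons z A =>
      rw [List.isChain_cons_cons] at hA'
      have ih := ih (fun a ha => hx a (by simpa using ha))
      have hz := hA z (by simp)
      obtain ⟨l, t, hl, -⟩ := exists_splitBy_cons r z (A ++ B)
      obtain ⟨l', t', hl', -⟩ := exists_splitBy_cons r' z (A ++ x :: B)
      simp only [List.cons_append] at ih ⊢
      rw [splitBy_cons_cons hl, splitBy_cons_cons hl', hA'.1]
      rw [hl, hl'] at ih
      cases r y z
      · simp only [Bool.false_eq_true, if_false]
        rw [insertRowsHl, if_neg (by simp [hy]), ih]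
      · simp only [if_true]
        rw [insertRowsHl] at ih ⊢
        have e : (y :: z :: l).any (fun y => decide (x ≤ y)) =
            (z :: l).any (fun y => decide (x ≤ y)) := by simp [hy]
        rw [e]
        split_ifs at ih ⊢ with h
        · simp [hy, hz] at ih ⊢
          exact ih
        · simp only [List.cons.injEq, true_and] at ih ⊢
          exact ih

/-! ## Quasi-ribbon tableaux and the hypoplactic congruence -/

/-- The letters `x < y` form an inversion in the word `w`. -/
def descent (w : List (Fin n)) (x y : Fin n) : Bool := decide (x < y ∧ [y, x].Sublist w)

/-- A letter added at the end can only be the smaller member of a new inversion. -/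
lemma descent_append_singleton {w : List (Fin n)} {x u v : Fin n} (h : u < v → u ≠ x) :
    descent (w ++ [x]) u v = descent w u v := by
  have hx : ¬ [v, u].Sublist [x] := fun h => by simpa using h.length_le
  simp only [descent, pair_sublist_append, List.mem_singleton, decide_eq_decide]
  tauto

lemma descent_cons {w : List (Fin n)} {x u v : Fin n} (h : u < v → v ≠ x) :
    descent (x :: w) u v = descent w u v := by
  simp only [descent, pair_sublist_cons, decide_eq_decide]
  tauto

lemma perm_readSW_flatten (q : ColString n) : (readSW q).Perm q.cols.flatten := by
  rw [readSW]
  induction q.cols with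
  | nil => exact List.Perm.refl _
  | cons c cs ih => simpa using (List.reverse_perm c).append ih

lemma pairwise_le_flatten {cs : List (List (Fin n))} (h : ∀ c ∈ cs, IsColumn c)
    (h' : cs.IsChain LeAll) : cs.flatten.Pairwise (· ≤ ·) ∧ cs.Pairwise LeAll := by
  induction cs with
  | nil => simp
  | cons c cs ih =>
    have ih := ih (fun c hc => h c (List.mem_cons_of_mem _ hc)) h'.tail
    have hc : ∀ s ∈ c, ∀ t ∈ cs.flatten, s ≤ t := by
      cases cs with
      | nil => simp
      | cons c' cs =>
        intro s hs t ht
        rw [List.isChain_cons_cons] at h'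
        obtain ⟨z, hz⟩ := List.exists_mem_of_ne_nil c' (h c' (by simp)).1
        rw [List.flatten_cons, List.mem_append] at ht
        rcases ht with ht | ht
        · exact h'.1 s hs t ht
        · rw [List.flatten_cons] at ih
          exact (h'.1 s hs z hz).trans ((List.pairwise_append.1 ih.1).2.2 z hz t ht)
    refine ⟨?_, List.pairwise_cons.2 ⟨fun c' hc' s hs t ht => ?_, ih.2⟩⟩
    · rw [List.flatten_cons]
      exact List.pairwise_append.2 ⟨(h c (by simp)).2.imp le_of_lt, ih.1, hc⟩
    · exact hc s hs t (List.mem_flatten.2 ⟨c', hc', ht⟩)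

/-- A quasi-ribbon tableau is determined by the class of its reading. -/
lemma cols_eq_splitBy {q : ColString n} (hq : q ∈ QuasiRibbon n) {w : List (Fin n)}
    (hw : HypoEquiv w (readSW q)) : q.cols = q.cols.flatten.splitBy (descent w) := by
  rw [mem_quasiRibbon_iff] at hq
  obtain ⟨h1, -, h2⟩ := hq
  have hmem : ∀ z, z ∈ w ↔ z ∈ q.cols.flatten := fun z =>
    hw.1.mem_iff.trans (perm_readSW_flatten q).mem_iff
  have hs := pairwise_le_flatten h1 h2
  refine (List.splitBy_eq_iff.2 ⟨rfl, fun h => (h1 _ h).1 rfl, fun c hc => ?_, ?_⟩).symm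
  -- Inside a column, neighbours x < y are consecutive in the support because the concatenated
  -- columns are sorted, and y is read before x.
  · obtain ⟨L, R, hLR⟩ := List.append_of_mem hc
    by_contra hch
    obtain ⟨C, x, y, D, rfl, hxy⟩ := exists_split_of_not_isChain hch
    have hlt : x < y := isChain_pair (h1 _ hc).2.isChain
    refine hxy (decide_eq_true ⟨hlt, (hw.2 x y hlt fun z hz => ?_).2 ?_⟩)
    · rw [hmem, hLR] at hz
      rw [hLR] at hs
      have := hs.1
      simp only [List.flatten_append, List.flatten_cons, List.append_assoc, List.cons_append,
        List.nil_append, List.pairwise_append, List.pairwise_cons, List.mem_append,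
        List.mem_cons] at this hz
      grind
    · rw [readSW, pair_sublist_flatten]
      refine Or.inl ⟨_, List.mem_map.2 ⟨_, hc, rfl⟩, ?_⟩
      rw [pair_sublist_reverse]
      exact ((List.Sublist.refl [x, y]).trans (List.sublist_append_right C _)).trans
        (List.sublist_append_left _ D)
  -- Between two columns, let x be the bottom of the first and y the top of the second. Everything
  -- read up to the first is at most x and everything read from the second on is at least y, so x <
  -- y cannot be inverted in the reading, nor in w since x and y are consecutive.
  · by_contra hch
    obtain ⟨L, c, c', R, hLR, hcc⟩ := exists_split_of_not_isChain hch
    have hc := h1 c (by simp [hLR])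
    have hc' := h1 c' (by simp [hLR])
    refine hcc ⟨hc.1, hc'.1, ?_⟩
    rw [descent, decide_eq_false_iff_not]
    rintro ⟨hlt, hsub⟩
    set x := c.getLast hc.1 with hx
    set y := c'.head hc'.1 with hy
    have hxc : x ∈ c := List.getLast_mem _
    have hyc : y ∈ c' := List.head_mem _
    have hcx : ∀ z ∈ c, z ≤ x := by
      intro z hz
      obtain ⟨i, hi, rfl⟩ := List.mem_iff_getElem.1 hz
      rw [hx, List.getLast_eq_getElem]
      exact hc.getElem_le (by omega) _
    have hcy : ∀ z ∈ c', y ≤ z := by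
      intro z hz
      obtain ⟨i, hi, rfl⟩ := List.mem_iff_getElem.1 hz
      rw [hy, List.head_eq_getElem]
      exact hc'.getElem_le (by omega) _
    have hL : ∀ d ∈ L, ∀ z ∈ d, z ≤ x := by
      have := hs.2
      rw [hLR, List.append_assoc, List.pairwise_append] at this
      exact fun d hd z hz => this.2.2 d hd c (by simp) z hz x hxc
    have hR : ∀ d ∈ R, ∀ z ∈ d, y ≤ z := by
      have := hs.2
      rw [hLR, List.pairwise_append] at this
      exact fun d hd z hz => this.2.2 c' (by simp) d hd y hyc z hz
    have h3 := (hw.2 x y hlt fun z hz => by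
      rw [hmem, hLR] at hz
      simp only [List.flatten_append, List.flatten_cons, List.flatten_nil, List.append_nil,
        List.mem_append, List.mem_flatten] at hz
      rcases hz with (⟨d, hd, hz⟩ | hz | hz) | ⟨d, hd, hz⟩
      · have := hL d hd z hz
        omega
      · have := hcx z hz
        omega
      · have := hcy z hz
        omega
      · have := hR d hd z hz
        omega).1 hsub
    rw [readSW, hLR, List.append_assoc, show L ++ ([c, c'] ++ R) = (L ++ [c]) ++ (c' :: R) by simp,
      List.map_append, List.flatten_append, pair_sublist_append] at h3
    have h4 : ∀ z ∈ ((L ++ [c]).map List.reverse).flatten, z ≤ x := by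
      intro z hz
      simp only [List.mem_flatten, List.mem_map, List.mem_append, List.mem_singleton] at hz
      obtain ⟨_, ⟨d, hd | rfl, rfl⟩, hz⟩ := hz
      · exact hL d hd z (List.mem_reverse.1 hz)
      · exact hcx z (List.mem_reverse.1 hz)
    have h5 : ∀ z ∈ ((c' :: R).map List.reverse).flatten, y ≤ z := by
      intro z hz
      simp only [List.mem_flatten, List.mem_map, List.mem_cons] at hz
      obtain ⟨_, ⟨d, rfl | hd, rfl⟩, hz⟩ := hz
      · exact hcy z (List.mem_reverse.1 hz)
      · exact hR d hd z (List.mem_reverse.1 hz)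
    rcases h3 with h3 | h3 | h3
    · exact absurd (h4 y (h3.subset (by simp))) (not_le.2 hlt)
    · exact absurd (h5 x (h3.subset (by simp))) (not_le.2 hlt)
    · exact absurd (h4 y h3.1) (not_le.2 hlt)

/-- The content gives the sorted word, the class gives the cuts into columns, and the gluing follows
from the columns. -/
lemma quasiRibbon_ext {q q' : ColString n} (hq : q ∈ QuasiRibbon n) (hq' : q' ∈ QuasiRibbon n)
    (h : HypoEquiv (readSW q) (readSW q')) : q = q' := by
  have h1 := cols_eq_splitBy hq (HypoEquiv.refl _)
  have h2 := cols_eq_splitBy hq' h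
  rw [mem_quasiRibbon_iff] at hq hq'
  have h3 : q.cols.flatten = q'.cols.flatten :=
    (((perm_readSW_flatten q).symm.trans h.1).trans (perm_readSW_flatten q')).eq_of_pairwise
      (fun a b _ _ => le_antisymm) (pairwise_le_flatten hq.1 hq.2.2).1
      (pairwise_le_flatten hq'.1 hq'.2.2).1
  rw [hq.2.1, hq'.2.1, h1, h2, h3]

lemma exists_quasiRibbon (w : List (Fin n)) : ∃ q ∈ QuasiRibbon n, HypoEquiv w (readSW q) := by
  -- The word itself as a string of one-box columns; their rows are irrelevant for the reading.
  have hP : ofPlaced (w.map fun x => ((0 : ℤ), [x])) ∈ Scol n := by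
    rw [ofPlaced_mem_Scol]
    intro y hy
    obtain ⟨x, -, rfl⟩ := List.mem_map.1 hy
    exact ⟨by simp, by simp⟩
  obtain ⟨q, hq, h⟩ := exists_reduction hP
  refine ⟨q, hq, ?_⟩
  have hw : readPlaced (w.map fun x => ((0 : ℤ), [x])) = w := by
    clear h hP
    induction w with
    | nil => rfl
    | cons x w ih =>
      rw [List.map_cons, readPlaced_cons, ih]
      rfl
  have := (preserves_of_reflTransGen h hP).2
  change HypoEquiv (readPlaced _) _ at this
  rwa [hw] at this

/-! ## Insertions into quasi-ribbon tableaux -/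

lemma exists_sorted_split {s : List (Fin n)} (hs : s.Pairwise (· ≤ ·)) (p : Fin n → Bool)
    (hp : ∀ x y, x ≤ y → p y = true → p x = true) :
    ∃ A B, s = A ++ B ∧ (∀ a ∈ A, p a = true) ∧ ∀ b ∈ B, p b = false := by
  induction s with
  | nil => exact ⟨[], [], by simp⟩
  | cons x s ih =>
    rw [List.pairwise_cons] at hs
    cases hx : p x
    · refine ⟨[], x :: s, rfl, by simp, fun b hb => ?_⟩
      rcases List.mem_cons.1 hb with rfl | hb
      · exact hx
      · by_contra h
        have := hp x b (hs.1 b hb) (by simpa using h)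
        simp [hx] at this
    · obtain ⟨A, B, rfl, hA, hB⟩ := ih hs.2
      exact ⟨x :: A, B, rfl, by simpa [hx] using hA, hB⟩

lemma le_of_mem_getLast? {A : List (Fin n)} (hA : A.Pairwise (· ≤ ·)) {a x : Fin n}
    (ha : a ∈ A.getLast?) (hx : x ∈ A) : x ≤ a := by
  obtain ⟨B, rfl⟩ : ∃ B, A = B ++ [a] := List.getLast?_eq_some_iff.1 ha
  rcases List.mem_append.1 hx with hx | hx
  · exact (List.pairwise_append.1 hA).2.2 x hx a (by simp)
  · exact (List.mem_singleton.1 hx).le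

lemma head?_le_of_mem {B : List (Fin n)} (hB : B.Pairwise (· ≤ ·)) {b x : Fin n}
    (hb : b ∈ B.head?) (hx : x ∈ B) : b ≤ x := by
  cases B with
  | nil => simp at hx
  | cons c B =>
    obtain rfl : c = b := by simpa using hb
    rcases List.mem_cons.1 hx with rfl | hx
    · exact le_rfl
    · exact (List.pairwise_cons.1 hB).1 x hx

lemma isChain_of_forall_mem {α : Type*} {r : α → α → Prop} {l : List α}
    (h : ∀ x ∈ l, ∀ y ∈ l, r x y) : l.IsChain r :=
  (isChain_congr_of_mem (s := fun _ _ => True) fun x hx y hy => by simp [h x hx y hy]).2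
    (List.Pairwise.isChain (List.pairwise_of_forall (by simp)))

lemma sorted_insert_unique {A B s : List (Fin n)} {x : Fin n} (hAB : (A ++ B).Pairwise (· ≤ ·))
    (hA : ∀ a ∈ A, a ≤ x) (hB : ∀ b ∈ B, x ≤ b) (hs : s.Pairwise (· ≤ ·))
    (hp : (x :: (A ++ B)).Perm s) : s = A ++ x :: B := by
  refine (hp.symm.trans List.perm_middle.symm).eq_of_pairwise (fun a b _ _ => le_antisymm) hs ?_
  rw [List.pairwise_append] at hAB ⊢
  refine ⟨hAB.1, List.pairwise_cons.2 ⟨hB, hAB.2.1⟩, fun a ha b hb => ?_⟩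
  rcases List.mem_cons.1 hb with rfl | hb
  · exact hA a ha
  · exact hAB.2.2 a ha b hb

/-- The result is compared with the quasi-ribbon tableau already known to exist in the class of the
extended word, so its tableau conditions need no separate verification. -/
lemma insertHr_spec {q : ColString n} (hq : q ∈ QuasiRibbon n) (x : Fin n) :
    insertHr q x ∈ QuasiRibbon n ∧ HypoEquiv (readSW q ++ [x]) (readSW (insertHr q x)) := by
  obtain ⟨q', hq', h'⟩ := exists_quasiRibbon (readSW q ++ [x])
  suffices h : insertHr q x = q' from h ▸ ⟨hq', h'⟩
  have e := cols_eq_splitBy hq (HypoEquiv.refl _)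
  have e' := cols_eq_splitBy hq' h'
  have hmem : ∀ z, z ∈ readSW q ↔ z ∈ q.cols.flatten := fun z => (perm_readSW_flatten q).mem_iff
  have hp : (x :: q.cols.flatten).Perm q'.cols.flatten :=
    ((((perm_readSW_flatten q).symm.cons x).trans (List.perm_append_singleton _ _).symm).trans
      h'.1).trans (perm_readSW_flatten q')
  rw [mem_quasiRibbon_iff] at hq hq'
  have hs := (pairwise_le_flatten hq.1 hq.2.2).1
  have hs' := (pairwise_le_flatten hq'.1 hq'.2.2).1
  rw [insertHr, hq'.2.1, e, e', ribbonTransposed_splitBy]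
  generalize q.cols.flatten = s at *
  generalize q'.cols.flatten = s' at *
  generalize readSW q = w at *
  obtain ⟨A, B, rfl, hA, hB⟩ := exists_sorted_split hs (fun y => decide (y ≤ x))
    (fun y z hyz hz => by simp only [decide_eq_true_eq] at hz ⊢; omega)
  simp only [decide_eq_true_eq, decide_eq_false_iff_not, not_le] at hA hB
  rw [sorted_insert_unique hs hA (fun b hb => (hB b hb).le) hs' hp,
    insertRowsHr_splitBy (r' := fun u v => !descent (w ++ [x]) u v) hA hB, ribbonTransposed_splitBy]
  · simp
  · refine isChain_of_forall_mem fun u _ v hv => ?_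
    have := hA v hv
    rw [descent_append_singleton (by omega)]
  · refine isChain_of_forall_mem fun u hu v _ => ?_
    have := hB u hu
    rw [descent_append_singleton (by omega)]
  -- An inversion of a < x would need an x in the old word. That x would lie in A, whose last and
  -- largest letter is a.
  · intro a ha
    simp only [descent, pair_sublist_append, Bool.not_eq_true', decide_eq_false_iff_not]
    rintro ⟨hlt, h | h | h⟩
    · have hx : x ∈ A := by
        have hx := (hmem x).1 (h.subset (by simp))
        rcases List.mem_append.1 hx with hx | hx
        · exact hx
        · exact absurd (hB x hx) (lt_irrefl _)
      exact absurd (le_of_mem_getLast? (List.pairwise_append.1 hs).1 ha hx) (not_le.2 hlt)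
    · simpa using h.length_le
    · simp at h
      omega
  -- Every letter b > x of the old word precedes the appended x, so x and b are inverted and the row
  -- breaks between them.
  · intro b hb
    have hb := List.mem_of_head? hb
    simp only [descent, pair_sublist_append, Bool.not_eq_false', decide_eq_true_eq]
    exact ⟨hB b hb, Or.inr (Or.inr ⟨(hmem b).2 (by simp [hb]), by simp⟩)⟩

lemma insertHl_spec {q : ColString n} (hq : q ∈ QuasiRibbon n) (x : Fin n) :
    insertHl q x ∈ QuasiRibbon n ∧ HypoEquiv (x :: readSW q) (readSW (insertHl q x)) := by
  obtain ⟨q', hq', h'⟩ := exists_quasiRibbon (x :: readSW q)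
  suffices h : insertHl q x = q' from h ▸ ⟨hq', h'⟩
  have e := cols_eq_splitBy hq (HypoEquiv.refl _)
  have e' := cols_eq_splitBy hq' h'
  have hmem : ∀ z, z ∈ readSW q ↔ z ∈ q.cols.flatten := fun z => (perm_readSW_flatten q).mem_iff
  have hp : (x :: q.cols.flatten).Perm q'.cols.flatten :=
    (((perm_readSW_flatten q).symm.cons x).trans h'.1).trans (perm_readSW_flatten q')
  rw [mem_quasiRibbon_iff] at hq hq'
  have hs := (pairwise_le_flatten hq.1 hq.2.2).1
  have hs' := (pairwise_le_flatten hq'.1 hq'.2.2).1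
  rw [insertHl, hq'.2.1, e, e', ribbonTransposed_splitBy]
  generalize q.cols.flatten = s at *
  generalize q'.cols.flatten = s' at *
  generalize readSW q = w at *
  obtain ⟨A, B, rfl, hA, hB⟩ := exists_sorted_split hs (fun y => decide (y < x))
    (fun y z hyz hz => by simp only [decide_eq_true_eq] at hz ⊢; omega)
  simp only [decide_eq_true_eq, decide_eq_false_iff_not, not_lt] at hA hB
  rw [sorted_insert_unique hs (fun a ha => (hA a ha).le) hB hs' hp,
    insertRowsHl_splitBy (r' := fun u v => !descent (x :: w) u v) hA hB, ribbonTransposed_splitBy]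
  · simp
  · refine isChain_of_forall_mem fun u _ v hv => ?_
    have := hA v hv
    rw [descent_cons (by omega)]
  · refine isChain_of_forall_mem fun u hu v _ => ?_
    have := hB u hu
    rw [descent_cons (by omega)]
  · intro a ha
    have ha := List.mem_of_getLast? ha
    simp only [descent, pair_sublist_cons, Bool.not_eq_false', decide_eq_true_eq]
    exact ⟨hA a ha, Or.inl ⟨trivial, (hmem a).2 (by simp [ha])⟩⟩
  · intro b hb
    simp only [descent, pair_sublist_cons, Bool.not_eq_true', decide_eq_false_iff_not]
    rintro ⟨hlt, h | h⟩
    · omega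
    · have hx : x ∈ B := by
        have hx := (hmem x).1 (h.subset (by simp))
        rcases List.mem_append.1 hx with hx | hx
        · exact absurd (hA x hx) (lt_irrefl _)
        · exact hx
      exact absurd (head?_le_of_mem (List.pairwise_append.1 hs).2.1 hb hx) (not_le.2 hlt)

lemma emptyString_mem_quasiRibbon : (emptyString : ColString n) ∈ QuasiRibbon n :=
  ⟨by simp [emptyString], rfl, by simp [emptyString]⟩

lemma constructRight_spec (w : List (Fin n)) : constructRight insertHr w ∈ QuasiRibbon n ∧
    HypoEquiv w (readSW (constructRight insertHr w)) := by
  induction w using List.reverseRecOn with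
  | nil => exact ⟨emptyString_mem_quasiRibbon, HypoEquiv.refl _⟩
  | append_singleton w x ih =>
    have := insertHr_spec ih.1 x
    rw [constructRight, List.foldl_append]
    exact ⟨this.1, (ih.2.append (HypoEquiv.refl [x])).trans this.2⟩

lemma constructLeft_spec (w : List (Fin n)) : constructLeft insertHl w ∈ QuasiRibbon n ∧
    HypoEquiv w (readSW (constructLeft insertHl w)) := by
  induction w with
  | nil => exact ⟨emptyString_mem_quasiRibbon, HypoEquiv.refl _⟩
  | cons x w ih =>
    have := insertHl_spec ih.1 x
    exact ⟨this.1, ((HypoEquiv.refl [x]).append ih.2).trans this.2⟩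

/-! ## The right-bottom rectification -/

/-- Any normal form is a quasi-ribbon tableau in the class of the reading of d, and the class
contains only one. -/
lemma existsUnique_normalForm {d : ColString n} (hd : d ∈ Scol n) :
    ∃! q, IsNormalFormOf d q := by
  obtain ⟨q, hq, h⟩ := exists_reduction hd
  refine ⟨q, ⟨h, irreducible_of_mem_quasiRibbon hq⟩, fun q' hq' => ?_⟩
  have h1 := preserves_of_reflTransGen h hd
  have h2 := preserves_of_reflTransGen hq'.1 hd
  exact quasiRibbon_ext (mem_quasiRibbon_of_irreducible h2.1 hq'.2) hq (h2.2.symm.trans h1.2)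

lemma rba_spec {d : ColString n} (hd : d ∈ Scol n) :
    rba d ∈ QuasiRibbon n ∧ HypoEquiv (readSW d) (readSW (rba d)) := by
  have h := (existsUnique_normalForm hd).exists
  rw [rba, dif_pos h]
  have h1 := preserves_of_reflTransGen h.choose_spec.1 hd
  exact ⟨mem_quasiRibbon_of_irreducible h1.1 h.choose_spec.2, h1.2⟩

/-! ## Young tableaux by rows or by columns -/

/-- The line `l'` is not longer than `l`, and its entries are related to those of `l` in the same
positions. -/
def Dominates (P : Fin n → Fin n → Bool) (l l' : List (Fin n)) : Prop :=
  l'.length ≤ l.length ∧ ∀ (i : ℕ) (a b : Fin n), l[i]? = some a → l'[i]? = some b → P a b = true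

/-- Tableaux given by their lines, where `P a b` is the relation from a line to the next one and
`P b a = false` is the relation inside a line: the rows of a Young tableau for `<` and its columns
for `≤`. -/
def IsTableau (P : Fin n → Fin n → Bool) (L : List (List (Fin n))) : Prop :=
  (∀ l ∈ L, l ≠ [] ∧ l.Pairwise fun a b => P b a = false) ∧ L.IsChain (Dominates P)

section Schensted

variable {P : Fin n → Fin n → Bool}

/-- C is the part before the first bumped entry and E starts with that entry. When E is empty, x is
appended, and `E.tail` = [] gives the same formula. -/
lemma schensted_cons {C E : List (Fin n)} {t : List (List (Fin n))} {x : Fin n}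
    (hC : ∀ c ∈ C, P x c = false) (hE : ∀ e ∈ E.head?, P x e = true) :
    schensted P ((C ++ E) :: t) x = (C ++ x :: E.tail) ::
      (match E.head? with
        | none => t
        | some y => schensted P t y) := by
  have hC' : C.find? (P x) = none := by simpa using hC
  cases E with
  | nil => simp [schensted, hC']
  | cons y E =>
    have hy : P x y = true := hE y (by simp)
    have hyC : y ∉ C := fun h => by simp [hC y h] at hy
    simp [schensted, List.find?_append, hC', hy, List.replace_append, hyC]

lemma exists_bumping_split (P : Fin n → Fin n → Bool) (r : List (Fin n)) (x : Fin n) :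
    ∃ C E, r = C ++ E ∧ (∀ c ∈ C, P x c = false) ∧ ∀ e ∈ E.head?, P x e = true := by
  induction r with
  | nil => exact ⟨[], [], by simp⟩
  | cons y r ih =>
    cases hy : P x y
    · obtain ⟨C, E, rfl, hC, hE⟩ := ih
      exact ⟨y :: C, E, rfl, by simpa [hy] using hC, hE⟩
    · exact ⟨[], y :: r, by simp [hy]⟩

/-- The axioms that `<` and `≤` have in common. -/
structure IsBumping (P : Fin n → Fin n → Bool) : Prop where
  trans : ∀ {a b c}, P a b = true → P b c = true → P a c = true
  of_not_left : ∀ {a b c}, P b a = false → P b c = true → P a c = true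

/-- The bumped letter y does not move further along the lines: an entry of C in the old position of
y would have to be bumped by y. So at its new position y is preceded in the upper line's position by
x or by some a that x does not bump, and both are related to y. What lies next to x was next to y
before, and transitivity applies. -/
lemma dominates_bump (hP : IsBumping P) {A B C E : List (Fin n)} {x y : Fin n}
    (h : Dominates P (A ++ y :: B) (C ++ E)) (hA : ∀ a ∈ A, P x a = false) (hxy : P x y = true)
    (hC : ∀ c ∈ C, P y c = false) : Dominates P (A ++ x :: B) (C ++ y :: E.tail) := by
  have hlen : C.length ≤ A.length := by
    by_contra hlt
    have h1 : (C ++ E)[A.length]? = some C[A.length] := by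
      rw [List.getElem?_append_left (by omega), List.getElem?_eq_getElem (by omega)]
    have := h.2 A.length y _ (by simp) h1
    rw [hC _ (List.getElem_mem _)] at this
    simp at this
  refine ⟨?_, fun i a b ha hb => ?_⟩
  · have := h.1
    simp only [List.length_append, List.length_cons, List.length_tail] at this ⊢
    omega
  · have ha' : i ≠ A.length → (A ++ y :: B)[i]? = some a := by
      intro hi
      rw [← ha]
      simp only [List.getElem?_append]
      split_ifs
      · rfl
      · rw [show i - A.length = i - A.length - 1 + 1 by omega]
        simp
    have hb' : i ≠ C.length → (C ++ E)[i]? = some b := by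
      intro hi
      rw [← hb]
      simp only [List.getElem?_append]
      split_ifs
      · rfl
      · rw [show i - C.length = i - C.length - 1 + 1 by omega]
        simp
    by_cases hiC : i = C.length
    · obtain rfl : y = b := by simpa [hiC] using hb
      rcases (hiC ▸ hlen).eq_or_lt with hi | hi
      · obtain rfl : x = a := by simpa [hi] using ha
        exact hxy
      · rw [List.getElem?_append_left hi] at ha
        exact hP.of_not_left (hA a (List.mem_of_getElem? ha)) hxy
    · by_cases hiA : i = A.length
      · obtain rfl : x = a := by simpa [hiA] using ha
        exact hP.trans hxy (h.2 i y b (by simp [hiA]) (hb' hiC))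
      · exact h.2 i a b (ha' hiA) (hb' hiC)

/-- The empty tableau is treated as one with empty first line, so that `dominates_bump` also covers
the case where a new line is created. -/
lemma exists_schensted_cons (P : Fin n → Fin n → Bool) (L : List (List (Fin n))) (x : Fin n) :
    ∃ C E t, schensted P L x = (C ++ x :: E.tail) :: t ∧ (∀ c ∈ C, P x c = false) ∧
      ((C ++ E) :: L.tail = L ∨ L = [] ∧ C = [] ∧ E = []) := by
  cases L with
  | nil => exact ⟨[], [], [], rfl, by simp, by simp⟩
  | cons r t =>
    obtain ⟨C, E, rfl, hC, hE⟩ := exists_bumping_split P r x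
    exact ⟨C, E, _, schensted_cons hC hE, hC, by simp⟩

lemma isTableau_schensted (hP : IsBumping P) {L : List (List (Fin n))} (hL : IsTableau P L)
    (x : Fin n) : IsTableau P (schensted P L x) := by
  induction L generalizing x with
  | nil => exact ⟨by simp [schensted], by simp [schensted]⟩
  | cons r t ih =>
    have ht : IsTableau P t := ⟨fun l hl => hL.1 l (List.mem_cons_of_mem _ hl), hL.2.tail⟩
    obtain ⟨C, E, rfl, hC, hE⟩ := exists_bumping_split P r x
    have hr := (hL.1 _ List.mem_cons_self).2
    rw [List.pairwise_append] at hr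
    have hline : (C ++ x :: E.tail) ≠ [] ∧ (C ++ x :: E.tail).Pairwise fun a b => P b a = false := by
      refine ⟨by simp, List.pairwise_append.2 ⟨hr.1, List.pairwise_cons.2 ⟨fun d hd => ?_, ?_⟩, ?_⟩⟩
      · cases E with
        | nil => simp at hd
        | cons y E =>
          by_contra hdx
          have := hP.trans (by simpa using hdx) (hE y (by simp))
          rw [(List.pairwise_cons.1 hr.2.1).1 d hd] at this
          simp at this
      · exact hr.2.1.sublist (List.tail_sublist _)
      · intro a ha b hb
        rcases List.mem_cons.1 hb with rfl | hb
        · exact hC a ha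
        · exact hr.2.2 a ha b (List.mem_of_mem_tail hb)
    rw [schensted_cons hC hE]
    cases E with
    | nil =>
      refine ⟨fun l hl => ?_, ?_⟩
      · rcases List.mem_cons.1 hl with rfl | hl
        · exact hline
        · exact ht.1 l hl
      · cases t with
        | nil => simp
        | cons s t =>
          have := hL.2
          simp only [List.head?_nil, List.isChain_cons_cons] at this ⊢
          refine ⟨⟨?_, fun i a b ha hb => ?_⟩, this.2⟩
          · have := this.1.1
            simp only [List.append_nil, List.tail_nil, List.length_append, List.length_cons,
              List.length_nil] at this ⊢
            omega
          · refine this.1.2 i a b ?_ hb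
            have hi : i < s.length := (List.getElem?_eq_some_iff.1 hb).1
            have hs : s.length ≤ C.length := by simpa using this.1.1
            rw [List.append_nil]
            rwa [List.getElem?_append_left (by omega)] at ha
    | cons y E =>
      have hxy := hE y (by simp)
      have ih := ih ht y
      obtain ⟨C', E', t', hs, hC', hE'⟩ := exists_schensted_cons P t y
      simp only [List.head?_cons, List.tail_cons] at hline ⊢
      rw [hs] at ih ⊢
      refine ⟨fun l hl => ?_, List.isChain_cons_cons.2 ⟨?_, ih.2⟩⟩
      · rcases List.mem_cons.1 hl with rfl | hl
        · exact hline
        · exact ih.1 l hl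
      · refine dominates_bump hP ?_ hC hxy hC'
        rcases hE' with hE' | ⟨rfl, rfl, rfl⟩
        · have := hL.2
          rw [← hE', List.isChain_cons_cons] at this
          exact this.1
        · exact ⟨by simp, by simp⟩

/-- Schensted's insertion stays in the class of the word of lines, for every congruence that is
compatible with bumping in a line. -/
lemma schensted_reading {r : List (Fin n) → List (Fin n) → Prop} (hrefl : ∀ u, r u u)
    (htrans : ∀ {u v w}, r u v → r v w → r u w)
    (happ : ∀ {u u' v v'}, r u u' → r v v' → r (u ++ v) (u' ++ v'))
    (hbump : ∀ {A B : List (Fin n)} {x y}, (∀ a ∈ A, P x a = false) → P x y = true →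
      (∀ b ∈ B, P b y = false) → r (A ++ y :: B ++ [x]) (y :: (A ++ x :: B)))
    {L : List (List (Fin n))} (hL : IsTableau P L) (x : Fin n) :
    r (L.reverse.flatten ++ [x]) (schensted P L x).reverse.flatten := by
  induction L generalizing x with
  | nil => exact hrefl _
  | cons l t ih =>
    have ih := ih ⟨fun l hl => hL.1 l (List.mem_cons_of_mem _ hl), hL.2.tail⟩
    obtain ⟨C, E, rfl, hC, hE⟩ := exists_bumping_split P l x
    have hl := (hL.1 _ List.mem_cons_self).2
    rw [schensted_cons hC hE]
    cases E with
    | nil => simpa using hrefl _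
    | cons y E =>
      -- One bump in the first line brings y to its front, hence to the end of the word of the
      -- remaining lines, where the induction inserts it.
      have h1 := hbump hC (hE y (by simp))
        (fun b hb => (List.pairwise_cons.1 (List.pairwise_append.1 hl).2.1).1 b hb)
      have h2 := happ (hrefl t.reverse.flatten) h1
      have h3 := happ (ih y) (hrefl (C ++ x :: E))
      simp only [List.head?_cons, List.tail_cons, List.reverse_cons, List.flatten_append,
        List.flatten_cons, List.flatten_nil, List.append_nil, List.append_assoc,
        List.cons_append, List.nil_append] at h2 h3 ⊢
      exact htrans h2 h3

end Schensted

/-! ## Transposition -/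

section Transposition

variable {P : Fin n → Fin n → Bool}

lemma Dominates.trans (hP : IsBumping P) {l l' l'' : List (Fin n)} (h : Dominates P l l')
    (h' : Dominates P l' l'') : Dominates P l l'' := by
  refine ⟨h'.1.trans h.1, fun i a c ha hc => ?_⟩
  have hi : i < l'.length := (List.getElem?_eq_some_iff.1 hc).1.trans_le h'.1
  exact hP.trans (h.2 i a _ ha (List.getElem?_eq_getElem hi))
    (h'.2 i _ c (List.getElem?_eq_getElem hi) hc)

lemma IsTableau.pairwise (hP : IsBumping P) {L : List (List (Fin n))} (hL : IsTableau P L) :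
    L.Pairwise (Dominates P) :=
  have : Trans (Dominates P) (Dominates P) (Dominates P) := ⟨Dominates.trans hP⟩
  List.isChain_iff_pairwise.1 hL.2

lemma length_le_height (L : List (List (Fin n))) {l : List (Fin n)} (hl : l ∈ L) :
    l.length ≤ (L.map List.length).foldr max 0 := by
  induction L with
  | nil => simp at hl
  | cons l' L ih =>
    simp only [List.map_cons, List.foldr_cons]
    rcases List.mem_cons.1 hl with rfl | hl
    · exact le_max_left _ _
    · exact (ih hl).trans (le_max_right _ _)

lemma exists_length_of_lt_height (L : List (List (Fin n))) {i : ℕ}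
    (hi : i < (L.map List.length).foldr max 0) : ∃ l ∈ L, i < l.length := by
  induction L with
  | nil => simp at hi
  | cons l L ih =>
    simp only [List.map_cons, List.foldr_cons, lt_max_iff] at hi
    rcases hi with hi | hi
    · exact ⟨l, by simp, hi⟩
    · obtain ⟨l', hl', h⟩ := ih hi
      exact ⟨l', List.mem_cons_of_mem _ hl', h⟩

/-- `filterMap` skips the lines that are too short. As lengths decrease, these come last, and no
index is shifted. -/
lemma getElem?_filterMap_getElem? {L : List (List (Fin n))}
    (hL : L.Pairwise fun l l' => l'.length ≤ l.length) (i j : ℕ) :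
    (L.filterMap fun s => s[i]?)[j]? = L[j]?.bind fun s => s[i]? := by
  induction L generalizing j with
  | nil => simp
  | cons l L ih =>
    rw [List.pairwise_cons] at hL
    cases hl : l[i]? with
    | none =>
      have hi : l.length ≤ i := by simpa using hl
      have h : ∀ s ∈ L, s[i]? = none := fun s hs => by
        have := hL.1 s hs
        simp
        omega
      rw [List.filterMap_cons_none (f := fun s : List (Fin n) => s[i]?) hl, List.filterMap_eq_nil_iff.2 h]
      cases j with
      | zero => simp [hl]
      | succ j =>
        cases hj : L[j]? with
        | none => simp [hj]
        | some s => simpa [hj] using h s (List.mem_of_getElem? hj)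
    | some v =>
      rw [List.filterMap_cons_some (f := fun s : List (Fin n) => s[i]?) hl]
      cases j with
      | zero => simp [hl]
      | succ j => simpa using ih hL.2 j

lemma getElem?_transposed (L : List (List (Fin n))) (i : ℕ) :
    (transposed L)[i]? = if i < (L.map List.length).foldr max 0 then
      some (L.filterMap fun s => s[i]?) else none := by
  rw [transposed, List.getElem?_map]
  split_ifs with h
  · rw [List.getElem?_range h]
    rfl
  · rw [List.getElem?_eq_none (by simpa using h)]
    rfl

lemma transposed_dual {L : List (List (Fin n))}
    (hL : L.Pairwise fun l l' => l'.length ≤ l.length) (i j : ℕ) :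
    ((transposed L)[i]?.bind fun s => s[j]?) = L[j]?.bind fun s => s[i]? := by
  rw [getElem?_transposed]
  split_ifs with h
  · exact getElem?_filterMap_getElem? hL i j
  · cases hj : L[j]? with
    | none => rfl
    | some s =>
      have := length_le_height L (List.mem_of_getElem? hj)
      simp
      omega

lemma transposed_flatten_perm (L : List (List (Fin n))) :
    (transposed L).flatten.Perm L.flatten := by
  -- The height is replaced by any bound m on the lengths, so that it stays fixed while the first
  -- line is peeled off. The letters of that line are distributed one by one to the fronts of the
  -- transposed lines.
  have key : ∀ (m : ℕ) (L : List (List (Fin n))), (∀ l ∈ L, l.length ≤ m) →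
      ((List.range m).map fun i : ℕ => L.filterMap fun s => s[i]?).flatten.Perm L.flatten := by
    intro m L
    induction L with
    | nil => simp
    | cons l L ih =>
      intro h
      have h1 : ∀ k, (List.range k).flatMap (fun i : ℕ => l[i]?.toList) = l.take k := by
        intro k
        induction k with
        | zero => simp
        | succ k ih => simp [List.range_succ, ih, List.take_add_one]
      have h2 := ih fun l hl => h l (List.mem_cons_of_mem _ hl)
      rw [← List.flatMap_def] at h2 ⊢
      have h3 := (List.flatMap_append_perm (List.range m) (fun i : ℕ => l[i]?.toList)
        (fun i : ℕ => L.filterMap fun s => s[i]?)).symm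
      rw [h1, List.take_of_length_le (h l (by simp))] at h3
      have h4 : (fun i : ℕ => (l :: L).filterMap fun s => s[i]?) =
          fun i : ℕ => l[i]?.toList ++ L.filterMap fun s => s[i]? := by
        funext i
        cases hl : l[i]? with
        | none => simp [List.filterMap_cons_none (f := fun s : List (Fin n) => s[i]?) hl]
        | some v => simp [List.filterMap_cons_some (f := fun s : List (Fin n) => s[i]?) hl]
      rw [h4]
      exact h3.trans (h2.append_left l)
  exact key _ L fun l hl => length_le_height L hl

/-- Transposition exchanges the relation inside lines with the relation between lines, which is
exactly the passage from P a b to the negation of P b a. -/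
lemma isTableau_transposed (hP : IsBumping P) {L : List (List (Fin n))} (hL : IsTableau P L) :
    IsTableau (fun a b => !P b a) (transposed L) := by
  have hpw := hL.pairwise hP
  have hlen : L.Pairwise fun l l' => l'.length ≤ l.length := hpw.imp fun h => h.1
  refine ⟨fun l hl => ?_, ?_⟩
  · obtain ⟨i, hi⟩ := List.mem_iff_getElem?.1 hl
    rw [getElem?_transposed] at hi
    split_ifs at hi with h
    obtain rfl := Option.some.inj hi
    refine ⟨?_, ?_⟩
    · obtain ⟨s, hs, hi'⟩ := exists_length_of_lt_height L h
      refine List.ne_nil_of_mem (a := s[i]) (List.mem_filterMap.2 ⟨s, hs, ?_⟩)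
      exact List.getElem?_eq_getElem hi'
    · rw [List.pairwise_filterMap]
      exact hpw.imp fun h a ha b hb => by simpa using h.2 i a b ha hb
  · rw [List.isChain_iff_getElem]
    intro i hi
    have h1 := transposed_dual hlen i
    have h2 := transposed_dual hlen (i + 1)
    rw [List.getElem?_eq_getElem (by omega)] at h1
    rw [List.getElem?_eq_getElem hi] at h2
    simp only [Option.bind_some] at h1 h2
    refine ⟨?_, fun j a b ha hb => ?_⟩
    · by_contra hlt
      have h3 := List.getElem?_eq_getElem (not_le.1 hlt)
      rw [h2] at h3
      have h4 := h1 (transposed L)[i].length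
      rw [List.getElem?_eq_none le_rfl] at h4
      obtain ⟨s, hs, h3⟩ := Option.bind_eq_some_iff.1 h3
      rw [hs, Option.bind_some, eq_comm, List.getElem?_eq_none_iff] at h4
      have := (List.getElem?_eq_some_iff.1 h3).1
      omega
    · rw [h1] at ha
      rw [h2] at hb
      obtain ⟨s, hs, ha⟩ := Option.bind_eq_some_iff.1 ha
      rw [hs, Option.bind_some] at hb
      obtain ⟨hi1, rfl⟩ := List.getElem?_eq_some_iff.1 ha
      obtain ⟨hi2, rfl⟩ := List.getElem?_eq_some_iff.1 hb
      have := List.pairwise_iff_getElem.1 (hL.1 s (List.mem_of_getElem? hs)).2 i (i + 1) hi1 hi2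
        (by omega)
      simpa using this

end Transposition

/-! ### Rows and columns of Young tableaux -/

lemma isBumping_le : IsBumping fun a b : Fin n => decide (a ≤ b) :=
  ⟨fun h h' => by simp only [decide_eq_true_eq] at *; omega,
    fun h h' => by simp only [decide_eq_true_eq, decide_eq_false_iff_not] at *; omega⟩

lemma isBumping_lt : IsBumping fun a b : Fin n => decide (a < b) :=
  ⟨fun h h' => by simp only [decide_eq_true_eq] at *; omega,
    fun h h' => by simp only [decide_eq_true_eq, decide_eq_false_iff_not] at *; omega⟩

lemma isTableau_rows {cs : List (List (Fin n))} (h : IsTableau (fun a b => decide (a ≤ b)) cs) :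
    IsTableau (fun a b => decide (a < b)) (transposed cs) := by
  convert isTableau_transposed isBumping_le h using 3
  rw [← decide_not, decide_eq_decide, not_le]

lemma isTableau_columns {rs : List (List (Fin n))} (h : IsTableau (fun a b => decide (a < b)) rs) :
    IsTableau (fun a b => decide (a ≤ b)) (transposed rs) := by
  convert isTableau_transposed isBumping_lt h using 3
  rw [← decide_not, decide_eq_decide, not_lt]

/-- The readings by columns and by rows of a Young tableau are equivalent. -/
lemma hypoEquiv_column_row {cs rs : List (List (Fin n))}
    (hc : IsTableau (fun a b => decide (a ≤ b)) cs) (hr : IsTableau (fun a b => decide (a < b)) rs)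
    (hd : ∀ i j : ℕ, (rs[i]?.bind fun s => s[j]?) = cs[j]?.bind fun s => s[i]?)
    (hp : cs.flatten.Perm rs.flatten) :
    HypoEquiv (cs.map List.reverse).flatten rs.reverse.flatten := by
  have hperm : ((cs.map List.reverse).flatten).Perm cs.flatten :=
    perm_readSW_flatten ⟨cs, []⟩
  refine ⟨(hperm.trans hp).trans (List.reverse_perm rs).symm.flatten, fun a b hab hz => ?_⟩
  have hcol : ∀ {j i i' : ℕ} {s : List (Fin n)} {x y : Fin n}, cs[j]? = some s → s[i]? = some x →
      s[i']? = some y → i < i' → x < y := by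
    intro j i i' s x y hs hx hy hii
    obtain ⟨h1, rfl⟩ := List.getElem?_eq_some_iff.1 hx
    obtain ⟨h2, rfl⟩ := List.getElem?_eq_some_iff.1 hy
    simpa using List.pairwise_iff_getElem.1 (hc.1 s (List.mem_of_getElem? hs)).2 i i' h1 h2 hii
  have hrow : ∀ {j j' : ℕ} {s s' : List (Fin n)}, cs[j]? = some s → cs[j']? = some s' → j < j' →
      s'.length ≤ s.length ∧ ∀ (i : ℕ) (x y : Fin n), s[i]? = some x → s'[i]? = some y → x ≤ y := by
    intro j j' s s' hs hs' hjj
    obtain ⟨h1, rfl⟩ := List.getElem?_eq_some_iff.1 hs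
    obtain ⟨h2, rfl⟩ := List.getElem?_eq_some_iff.1 hs'
    have := List.pairwise_iff_getElem.1 (hc.pairwise isBumping_le) j j' h1 h2 hjj
    exact ⟨this.1, fun i x y hx hy => by simpa using this.2 i x y hx hy⟩
  constructor
  · intro h
    obtain ⟨i, j, i', j', s, s', hjj, hs, hs', hb, ha⟩ : ∃ (i j i' j' : ℕ) (s s' : List (Fin n)),
        j ≤ j' ∧ cs[j]? = some s ∧ cs[j']? = some s' ∧ s[i]? = some b ∧ s'[i']? = some a := by
      rcases pair_sublist_flatten.1 h with ⟨l, hl, h⟩ | ⟨l, l', h, hb, ha⟩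
      · obtain ⟨s, hs, rfl⟩ := List.mem_map.1 hl
        obtain ⟨j, hj⟩ := List.mem_iff_getElem?.1 hs
        obtain ⟨i, hi⟩ := List.mem_iff_getElem?.1 (List.mem_reverse.1 (h.subset List.mem_cons_self))
        obtain ⟨i', hi'⟩ := List.mem_iff_getElem?.1
          (List.mem_reverse.1 (h.subset (List.mem_cons_of_mem _ List.mem_cons_self)))
        exact ⟨i, j, i', j, s, s, le_rfl, hj, hj, hi, hi'⟩
      · obtain ⟨j, j', hjj, hj, hj'⟩ := pair_sublist_iff_getElem?.1 h
        rw [List.getElem?_map, Option.map_eq_some_iff] at hj hj'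
        obtain ⟨s, hs, rfl⟩ := hj
        obtain ⟨s', hs', rfl⟩ := hj'
        obtain ⟨i, hi⟩ := List.mem_iff_getElem?.1 (List.mem_reverse.1 hb)
        obtain ⟨i', hi'⟩ := List.mem_iff_getElem?.1 (List.mem_reverse.1 ha)
        exact ⟨i, j, i', j', s, s', hjj.le, hs, hs', hi, hi'⟩
    -- If b were in a higher row than a or in the same one, the entry in the column of b and the row
    -- of a would give b ≤ a. So b stands strictly lower and is read first by rows. Consecutiveness
    -- is not needed in this direction.
    have hii : i' < i := by
      by_contra hii
      have hle : s'.length ≤ s.length := by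
        rcases hjj.eq_or_lt with rfl | hjj
        · rw [Option.some.inj (hs.symm.trans hs')]
        · exact (hrow hs hs' hjj).1
      have hi' : i' < s.length := (List.getElem?_eq_some_iff.1 ha).1.trans_le hle
      have hy := List.getElem?_eq_getElem hi'
      have h1 : b ≤ s[i'] := by
        rcases (not_lt.1 hii).eq_or_lt with rfl | hii
        · exact (Option.some.inj (hb.symm.trans hy)).le
        · exact (hcol hs hb hy hii).le
      have h2 : s[i'] ≤ a := by
        rcases hjj.eq_or_lt with rfl | hjj
        · obtain rfl := Option.some.inj (hs.symm.trans hs')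
          exact (Option.some.inj (hy.symm.trans ha)).le
        · exact (hrow hs hs' hjj).2 i' _ _ hy ha
      omega
    have e1 := hd i j
    have e2 := hd i' j'
    rw [hs, Option.bind_some, hb] at e1
    rw [hs', Option.bind_some, ha] at e2
    obtain ⟨r, hr1, hr2⟩ := Option.bind_eq_some_iff.1 e1
    obtain ⟨r', hr1', hr2'⟩ := Option.bind_eq_some_iff.1 e2
    refine pair_sublist_flatten.2 (Or.inr ⟨r, r', ?_, List.mem_of_getElem? hr2,
      List.mem_of_getElem? hr2'⟩)
    rw [pair_sublist_reverse]
    exact pair_sublist_iff_getElem?.2 ⟨i', i, hii, hr1', hr1⟩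
  · intro h
    obtain ⟨i, j, i', j', r, r', hii, hs, hs', hb, ha⟩ : ∃ (i j i' j' : ℕ) (r r' : List (Fin n)),
        i' < i ∧ rs[i]? = some r ∧ rs[i']? = some r' ∧ r[j]? = some b ∧ r'[j']? = some a := by
      rcases pair_sublist_flatten.1 h with ⟨l, hl, h⟩ | ⟨l, l', h, hb, ha⟩
      · obtain ⟨j, j', hjj, hj, hj'⟩ := pair_sublist_iff_getElem?.1 h
        obtain ⟨h1, rfl⟩ := List.getElem?_eq_some_iff.1 hj
        obtain ⟨h2, rfl⟩ := List.getElem?_eq_some_iff.1 hj'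
        have := List.pairwise_iff_getElem.1 (hr.1 l (List.mem_reverse.1 hl)).2 j j' h1 h2 hjj
        simp only [decide_eq_false_iff_not] at this
        exact absurd hab this
      · rw [pair_sublist_reverse] at h
        obtain ⟨i', i, hii, hi', hi⟩ := pair_sublist_iff_getElem?.1 h
        obtain ⟨j, hj⟩ := List.mem_iff_getElem?.1 hb
        obtain ⟨j', hj'⟩ := List.mem_iff_getElem?.1 ha
        exact ⟨i, j, i', j', l, l', hii, hi, hi', hj, hj'⟩
    have e1 := hd i j
    have e2 := hd i' j'
    rw [hs, Option.bind_some, hb] at e1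
    rw [hs', Option.bind_some, ha] at e2
    obtain ⟨s, hs, hb⟩ := Option.bind_eq_some_iff.1 e1.symm
    obtain ⟨s', hs', ha⟩ := Option.bind_eq_some_iff.1 e2.symm
    have hi : i < s.length := (List.getElem?_eq_some_iff.1 hb).1
    have hsame : ∀ {i'}, s[i']? = some a → i' < i → [b, a].Sublist (cs.map List.reverse).flatten := by
      intro i' ha hii
      refine pair_sublist_flatten.2 (Or.inl ⟨s.reverse,
        List.mem_map.2 ⟨s, List.mem_of_getElem? hs, rfl⟩, ?_⟩)
      rw [pair_sublist_reverse]
      exact pair_sublist_iff_getElem?.2 ⟨i', i, hii, ha, hb⟩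
    rcases lt_trichotomy j j' with hjj | rfl | hjj
    · refine pair_sublist_flatten.2 (Or.inr ⟨s.reverse, s'.reverse, ?_,
        List.mem_reverse.2 (List.mem_of_getElem? hb), List.mem_reverse.2 (List.mem_of_getElem? ha)⟩)
      exact pair_sublist_iff_getElem?.2 ⟨j, j', hjj, by simp [hs], by simp [hs']⟩
    · obtain rfl := Option.some.inj (hs.symm.trans hs')
      exact hsame ha hii
    -- The one case that needs consecutiveness: b is strictly to the right of a and below it. The
    -- entry in the row of a and the column of b lies in [a, b), hence equals a, and that occurrence
    -- of a is above b in one column.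
    · have hy : s[i']? = some s[i'] := List.getElem?_eq_getElem (by omega)
      have h1 := (hrow hs' hs hjj).2 i' a _ ha hy
      have h2 := hcol hs hy hb hii
      have h3 := hz s[i'] (hperm.mem_iff.2 (List.mem_flatten.2
        ⟨s, List.mem_of_getElem? hs, List.getElem_mem _⟩))
      have h4 : s[i'] = a := by omega
      exact hsame (by rw [hy, h4]) hii

/-! ## Schensted insertion into Young tableaux -/

lemma mem_young_iff {d : ColString n} : d ∈ Young n ↔
    d = topGlued d.cols ∧ IsTableau (fun a b => decide (a ≤ b)) d.cols := by
  have hcol : ∀ c : List (Fin n), IsColumn c ↔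
      c ≠ [] ∧ c.Pairwise fun a b => decide (b ≤ a) = false := by
    simp [IsColumn]
  simp only [Young, Set.mem_ofPred_eq, IsTableau, hcol]
  rw [and_left_comm]
  refine and_congr_right fun _ => and_congr_right fun h => isChain_congr_of_mem fun c hc c' hc' => ?_
  refine and_congr_right fun hle => ?_
  have h1 := List.length_pos_iff.2 (h c hc).1
  have h2 := List.length_pos_iff.2 (h c' hc').1
  simp only [decide_eq_true_eq]
  constructor
  · intro hf i a b ha hb
    obtain ⟨h3, rfl⟩ := List.getElem?_eq_some_iff.1 ha
    obtain ⟨h4, rfl⟩ := List.getElem?_eq_some_iff.1 hb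
    exact hf.2.2 i i h3 h4 (by omega)
  · refine fun hf => ⟨by omega, by omega, fun a b ha hb hab => ?_⟩
    obtain rfl : b = a := by omega
    exact hf b _ _ (List.getElem?_eq_getElem ha) (List.getElem?_eq_getElem hb)

lemma young_subset_Scol : Young n ⊆ Scol n := by
  intro d hd
  refine ⟨hd.1, ?_⟩
  rw [hd.2.1]
  simp [topGlued]

lemma topGlued_mem_young {cs : List (List (Fin n))}
    (h : IsTableau (fun a b => decide (a ≤ b)) cs) : topGlued cs ∈ Young n :=
  mem_young_iff.2 ⟨rfl, h⟩

lemma insertSl_spec {d : ColString n} (hd : d ∈ Young n) (x : Fin n) :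
    insertSl d x ∈ Young n ∧ HypoEquiv (x :: readSW d) (readSW (insertSl d x)) := by
  rw [mem_young_iff] at hd
  refine ⟨topGlued_mem_young (isTableau_schensted isBumping_le hd.2 x), ?_⟩
  -- Up to reversal, the column reading is the word of columns from last to first, each from top to
  -- bottom, which is the form used by `schensted_reading`.
  have hread : ∀ w : ColString n, readSW w = w.cols.reverse.flatten.reverse := by
    intro w
    rw [readSW, List.reverse_flatten, List.map_reverse, List.reverse_reverse]
  rw [hread, hread]
  have := schensted_reading (r := fun u v => HypoEquiv u.reverse v.reverse)
    (fun u => HypoEquiv.refl _) HypoEquiv.trans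
    (fun h h' => by simpa using h'.append h)
    (fun hA hxy hB => hypoEquiv_bump_column (by simpa using hA) (by simpa using hxy)
      (by simpa using hB)) hd.2 x
  simpa [insertSl, topGlued] using this

/-- Row bumping is visible in the row reading, so the argument passes from columns to rows, inserts,
and passes back. -/
lemma insertSr_spec {d : ColString n} (hd : d ∈ Young n) (x : Fin n) :
    insertSr d x ∈ Young n ∧ HypoEquiv (readSW d ++ [x]) (readSW (insertSr d x)) := by
  rw [mem_young_iff] at hd
  have hr := isTableau_rows hd.2
  have hr' := isTableau_schensted isBumping_lt hr x
  have hc' := isTableau_columns hr'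
  refine ⟨topGlued_mem_young hc', ?_⟩
  have h1 := hypoEquiv_column_row hd.2 hr
    (transposed_dual ((hd.2.pairwise isBumping_le).imp fun h => h.1))
    (transposed_flatten_perm _).symm
  have h2 := hypoEquiv_column_row hc' hr'
    (fun i j => (transposed_dual ((hr'.pairwise isBumping_lt).imp fun h => h.1) j i).symm)
    (transposed_flatten_perm _)
  have h3 := schensted_reading (r := HypoEquiv) HypoEquiv.refl HypoEquiv.trans HypoEquiv.append
    (fun hA hxy hB => hypoEquiv_bump_row (by simpa using hA) (by simpa using hxy)
      (by simpa using hB)) hr x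
  exact ((h1.append (HypoEquiv.refl [x])).trans h3).trans h2.symm

/-! ## Compatibility of the crystal operators with the hypoplactic congruence -/

lemma pair_sublist_middle {α : Type*} {m a b : α} {A B : List α} :
    [b, a].Sublist (A ++ m :: B) ↔ [b, a].Sublist (A ++ B) ∨ (b = m ∧ a ∈ B) ∨ b ∈ A ∧ a = m := by
  simp only [pair_sublist_append, pair_sublist_cons, List.mem_cons]
  tauto

/-- A dictionary expressing the inversions after an arrow through those before it, according to
which of the two letters is i or i + 1. If i + 1 is new in the word, it inherits the inversions of i
with larger letters; if i has disappeared, i + 1 has the inversions of i with smaller ones. -/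
lemma pair_sublist_replace {α : Type*} {lo hi : α} (hne : lo ≠ hi) {A B : List α} (hA : hi ∉ A)
    (hB : lo ∉ B) (a b : α) :
    ¬ [hi, lo].Sublist (A ++ hi :: B) ∧
    (b ≠ hi → b ≠ lo → hi ∈ A ++ lo :: B →
      ([b, hi].Sublist (A ++ hi :: B) ↔ [b, hi].Sublist (A ++ lo :: B))) ∧
    (b ≠ hi → b ≠ lo → hi ∉ A ++ lo :: B →
      ([b, hi].Sublist (A ++ hi :: B) ↔ [b, lo].Sublist (A ++ lo :: B))) ∧
    (a ≠ hi → a ≠ lo → lo ∉ A ++ hi :: B →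
      ([hi, a].Sublist (A ++ hi :: B) ↔ [lo, a].Sublist (A ++ lo :: B))) ∧
    (a ≠ hi → a ≠ lo → lo ∈ A ++ hi :: B →
      ([lo, a].Sublist (A ++ hi :: B) ↔ [lo, a].Sublist (A ++ lo :: B))) ∧
    (a ≠ hi → a ≠ lo → b ≠ hi → b ≠ lo →
      ([b, a].Sublist (A ++ hi :: B) ↔ [b, a].Sublist (A ++ lo :: B))) := by
  have hm : ∀ {x y : α} {w : List α}, [x, y].Sublist w → x ∈ w ∧ y ∈ w := fun h =>
    ⟨h.subset (by simp), h.subset (by simp)⟩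
  have hlo : ∀ {y}, [lo, y].Sublist (A ++ B) → lo ∈ A := fun h => by
    have := (hm h).1
    simpa [hB] using this
  have hlo' : ∀ {y}, [y, lo].Sublist (A ++ B) → y ∈ A := fun h => by
    rcases pair_sublist_append.1 h with h | h | h
    · exact (hm h).1
    · exact absurd (hm h).2 hB
    · exact h.1
  have hhi : ∀ {y}, [hi, y].Sublist (A ++ B) → y ∈ B := fun h => by
    rcases pair_sublist_append.1 h with h | h | h
    · exact absurd (hm h).1 hA
    · exact (hm h).2
    · exact h.2
  have happ : ∀ {x y}, x ∈ A → y ∈ B → [x, y].Sublist (A ++ B) := fun hx hy =>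
    pair_sublist_append.2 (Or.inr (Or.inr ⟨hx, hy⟩))
  simp only [pair_sublist_middle, hA, hB, hne, hne.symm, and_false, false_and, or_false, and_true,
    true_and]
  refine ⟨fun h => hB (hhi h), fun hb hb' h => ?_, fun hb _ h => ?_, fun _ ha' h => ?_,
    fun ha ha' h => ?_, fun ha ha' hb hb' => ?_⟩
  · have h : hi ∈ B := by simpa [hA, hne.symm] using h
    simp only [hb, hb', false_and, false_or, or_false]
    exact ⟨fun h' => h'.elim id fun h' => happ h' h, Or.inl⟩
  · have h : hi ∉ A ++ B := fun h' => h (by simpa [hne.symm] using h')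
    simp only [hb, false_and, false_or]
    exact ⟨fun h' => h'.elim (fun h' => absurd (hm h').2 h) Or.inr,
      fun h' => h'.elim (fun h' => Or.inr (hlo' h')) Or.inr⟩
  · have h : lo ∉ A ++ B := fun h' => h (by simpa [hne] using h')
    simp only [ha', and_false, or_false]
    exact ⟨fun h' => h'.elim (fun h' => Or.inr (hhi h')) Or.inr,
      fun h' => h'.elim (fun h' => absurd (hm h').1 h) Or.inr⟩
  · have h : lo ∈ A := by simpa [hB, hne] using h
    simp only [ha, ha', and_false, or_false]
    exact ⟨Or.inl, fun h' => h'.elim id fun h' => happ h h'⟩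
  · simp only [ha, ha', hb, hb', false_and, and_false, or_false]

/-- Each pair consecutive in the support of v either cannot be inverted, or has its inversion
determined by a pair consecutive in the support of u, by `pair_sublist_replace`. The same
translation holds for u' and v' since the contents agree. -/
lemma HypoEquiv.arrow {u u' v v' : List (Fin n)} (hu : HypoEquiv u u') {i : ℕ}
    (h : Arrow i u v) (h' : Arrow i u' v') : HypoEquiv v v' := by
  obtain ⟨hi, A, B, rfl, rfl, hA, hB⟩ := arrow_iff.1 h
  obtain ⟨_, A', B', rfl, rfl, hA', hB'⟩ := arrow_iff.1 h'
  clear h h'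
  have hlt : (⟨i, by omega⟩ : Fin n) < ⟨i + 1, hi⟩ := by simp [Fin.lt_def]
  have hsucc : ∀ z : Fin n, (⟨i, by omega⟩ : Fin n) < z → ⟨i + 1, hi⟩ ≤ z := by
    intro z hz
    simp only [Fin.lt_def, Fin.le_def] at hz ⊢
    omega
  revert hA hB hA' hB' hu hlt hsucc
  generalize (⟨i, by omega⟩ : Fin n) = lo
  generalize (⟨i + 1, hi⟩ : Fin n) = hi
  intro hA hB hu hA' hB' hlt hsucc
  have hp : (A ++ hi :: B).Perm (A' ++ hi :: B') := by
    have h1 := hu.1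
    refine List.perm_middle.trans (List.Perm.trans ?_ List.perm_middle.symm)
    exact ((List.perm_cons lo).1 ((List.perm_middle.symm.trans h1).trans List.perm_middle)).cons hi
  refine ⟨hp, fun a b hab hz => ?_⟩
  obtain ⟨k1, k2, k3, k4, k5, k6⟩ := pair_sublist_replace hlt.ne hA hB a b
  obtain ⟨k1', k2', k3', k4', k5', k6'⟩ := pair_sublist_replace hlt.ne hA' hB' a b
  have hmu := fun z => hu.1.mem_iff (a := z)
  have hmv := fun z => hp.mem_iff (a := z)
  have hhi := hz hi (by simp)
  -- The support of u exceeds that of v by at most lo, so only lo can spoil consecutiveness in u.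
  have huv : ∀ z ∈ A ++ lo :: B, z = lo ∨ ¬ (a < z ∧ z < b) := by
    intro z hzu
    rcases List.mem_append.1 hzu with hzu | hzu
    · exact Or.inr (hz z (List.mem_append_left _ hzu))
    · rcases List.mem_cons.1 hzu with hzu | hzu
      · exact Or.inl hzu
      · exact Or.inr (hz z (List.mem_append_right _ (List.mem_cons_of_mem _ hzu)))
  by_cases ha1 : a = hi
  · subst ha1
    have hb2 : b ≠ lo := by
      rintro rfl
      exact absurd hab (not_lt.2 hlt.le)
    by_cases hmem : a ∈ A ++ lo :: B
    · rw [k2 hab.ne' hb2 hmem, k2' hab.ne' hb2 ((hmu a).1 hmem)]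
      refine hu.2 a b hab fun z hzu => ?_
      rcases huv z hzu with rfl | h
      · exact fun h => absurd h.1 (not_lt.2 hlt.le)
      · exact h
    · rw [k3 hab.ne' hb2 hmem, k3' hab.ne' hb2 (mt (hmu a).2 hmem)]
      refine hu.2 lo b (hlt.trans hab) fun z hzu => ?_
      rcases huv z hzu with rfl | h
      · exact fun h => absurd h.1 (lt_irrefl _)
      · rintro ⟨h1, h2⟩
        rcases (hsucc z h1).eq_or_lt with rfl | h3
        · exact hmem hzu
        · exact h ⟨h3, h2⟩
  -- As hi occurs in v, the only letter consecutive to lo from above is hi, and this pair is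
  -- inverted in neither target.
  · by_cases ha2 : a = lo
    · subst ha2
      have hb : b = hi := by
        have := hsucc b hab
        by_contra hne
        exact hhi ⟨hlt, lt_of_le_of_ne this (Ne.symm hne)⟩
      subst hb
      exact iff_of_false k1 k1'
    · by_cases hb1 : b = hi
      · subst hb1
        have halo : a < lo := by
          rcases lt_trichotomy a lo with h | h | h
          · exact h
          · exact absurd h ha2
          · exact absurd hab (not_lt.2 (hsucc a h))
        -- A remaining lo would lie between a and hi. So lo has disappeared, and hi takes over its
        -- inversions with smaller letters.
        have hlo : lo ∉ A ++ b :: B := fun h => hz lo h ⟨halo, hlt⟩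
        rw [k4 ha1 ha2 hlo, k4' ha1 ha2 (mt (hmv lo).2 hlo)]
        refine hu.2 a lo halo fun z hzu => ?_
        rcases huv z hzu with rfl | h
        · exact fun h => absurd h.2 (lt_irrefl _)
        · exact fun h' => h ⟨h'.1, h'.2.trans hlt⟩
      · by_cases hb2 : b = lo
        · subst hb2
          by_cases hlo : b ∈ A ++ hi :: B
          · rw [k5 ha1 ha2 hlo, k5' ha1 ha2 ((hmv b).1 hlo)]
            refine hu.2 a b hab fun z hzu => ?_
            rcases huv z hzu with rfl | h
            · exact fun h => absurd h.2 (lt_irrefl _)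
            · exact h
          · have hlo' := mt (hmv b).2 hlo
            exact iff_of_false (fun h => hlo (h.subset (by simp)))
              (fun h => hlo' (h.subset (by simp)))
        · rw [k6 ha1 ha2 hb1 hb2, k6' ha1 ha2 hb1 hb2]
          refine hu.2 a b hab fun z hzu => ?_
          rcases huv z hzu with rfl | h
          · rintro ⟨h1, h2⟩
            exact hhi ⟨h1.trans hlt, lt_of_le_of_ne (hsucc b h2) (Ne.symm hb1)⟩
          · exact h

/-! ## Standardization and shapes -/

/-- The first column is read before the second, so the row condition says that certain earlier
positions do not exceed certain later ones, which the inversion table records. -/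
lemma Fits.of_inversionTable_eq {c d c' d' : List (Fin n)} {q : ℤ} (hf : Fits c q d)
    (hc : c.length = c'.length) (hd : d.length = d'.length)
    (h : inversionTable (c.reverse ++ d.reverse) = inversionTable (c'.reverse ++ d'.reverse)) :
    Fits c' q d' := by
  obtain ⟨h1, h2, h3⟩ := hf
  refine ⟨h1, by omega, fun a b ha hb hab => ?_⟩
  have h4 := h3 a b (by omega) (by omega) (by omega)
  have key := lt_iff_of_inversionTable_eq h (p := c.length - 1 - a)
    (q := c.length + (d.length - 1 - b)) (by omega) (by simp; omega) (by simp; omega)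
  rw [List.getElem_append_right (by simp), List.getElem_append_left (by simp; omega),
    List.getElem_append_right (by simp; omega), List.getElem_append_left (by simp; omega)] at key
  simp only [List.getElem_reverse, List.length_reverse] at key
  have e1 : c.length - 1 - (c.length - 1 - a) = a := by omega
  have e2 : d.length - 1 - (c.length + (d.length - 1 - b) - c.length) = b := by omega
  have e3 : c'.length - 1 - (c.length - 1 - a) = a := by omega
  have e4 : d'.length - 1 - (c.length + (d.length - 1 - b) - c'.length) = b := by omega
  simp only [e1, e2, e3, e4] at key
  exact not_lt.1 (mt key.2 (not_lt.2 h4))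

/-- The word v is cut into blocks of the lengths of the given columns. Blocks are again columns,
since strict decrease in the reading is recorded in the table. The relation `S` stands for the shape
condition between neighbours, for Young and for quasi-ribbon tableaux alike. -/
lemma exists_columns_of_inversionTable_eq {S : List (Fin n) → List (Fin n) → Prop}
    (hS : ∀ {c d c' d' : List (Fin n)}, c.length = c'.length → d.length = d'.length →
      inversionTable (c.reverse ++ d.reverse) = inversionTable (c'.reverse ++ d'.reverse) →
      S c d → S c' d')
    {cs : List (List (Fin n))} {v : List (Fin n)} (hcs : ∀ c ∈ cs, IsColumn c) (hch : cs.IsChain S)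
    (h : inversionTable (cs.map List.reverse).flatten = inversionTable v) :
    ∃ cs' : List (List (Fin n)), (cs'.map List.reverse).flatten = v ∧ (∀ c ∈ cs', IsColumn c) ∧
      cs'.IsChain S ∧ cs'.map List.length = cs.map List.length := by
  induction cs generalizing v with
  | nil =>
    have := length_eq_of_inversionTable_eq h
    exact ⟨[], (List.length_eq_zero_iff.1 (by simpa using this.symm)).symm, by simp⟩
  | cons c cs ih =>
    have hl := length_eq_of_inversionTable_eq h
    simp only [List.map_cons, List.flatten_cons, List.length_append, List.length_reverse] at hl
    have hv := List.take_append_drop c.length v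
    have hl1 : (v.take c.length).length = c.length := by
      rw [List.length_take]
      omega
    generalize v.take c.length = v₁ at hv hl1
    generalize v.drop c.length = v₂ at hv
    subst hv
    rw [List.map_cons, List.flatten_cons] at h
    obtain ⟨h1, h2⟩ := inversionTable_append_inj h (by simp [hl1])
    obtain ⟨cs', rfl, hcs', hch', hlen⟩ :=
      ih (fun c hc => hcs c (List.mem_cons_of_mem _ hc)) hch.tail h2
    refine ⟨v₁.reverse :: cs', by simp, fun c' hc' => ?_, ?_, by simp [hlen, hl1]⟩
    · rcases List.mem_cons.1 hc' with rfl | hc'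
      · have hc := hcs c (by simp)
        refine ⟨?_, ?_⟩
        · have := List.length_pos_iff.2 hc.1
          exact List.ne_nil_of_length_pos (by simp; omega)
        · rw [List.pairwise_reverse]
          exact pairwise_gt_of_inversionTable_eq h1 (List.pairwise_reverse.2 hc.2)
      · exact hcs' c' hc'
    · cases cs with
      | nil =>
        obtain rfl : cs' = [] := by simpa using hlen
        simp
      | cons d cs =>
        cases cs' with
        | nil => simp at hlen
        | cons d' cs' =>
          rw [List.isChain_cons_cons] at hch ⊢
          simp only [List.map_cons, List.cons.injEq] at hlen
          refine ⟨hS (by simp [hl1]) hlen.1.symm ?_ hch.1, hch'⟩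
          simp only [List.map_cons, List.flatten_cons, ← List.append_assoc] at h
          rw [List.reverse_reverse]
          exact (inversionTable_append_inj h (by simp [hl1, hlen.1])).1

lemma exists_young_of_inversionTable_eq {d : ColString n} (hd : d ∈ Young n) {v : List (Fin n)}
    (h : inversionTable (readSW d) = inversionTable v) : ∃ d' ∈ Young n, readSW d' = v := by
  obtain ⟨cs, h1, h2, h3, -⟩ := exists_columns_of_inversionTable_eq
    (S := fun c c' => c'.length ≤ c.length ∧ Fits c c'.length c')
    (fun hc hd' ht hS => ⟨by omega, by rw [← hd']; exact hS.2.of_inversionTable_eq hc hd' ht⟩)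
    hd.1 hd.2.2 h
  exact ⟨topGlued cs, ⟨h2, rfl, h3⟩, h1⟩

lemma exists_quasiRibbon_of_inversionTable_eq {q : ColString n} (hq : q ∈ QuasiRibbon n)
    {v : List (Fin n)} (h : inversionTable (readSW q) = inversionTable v) :
    ∃ q' ∈ QuasiRibbon n, readSW q' = v := by
  obtain ⟨cs, h1, h2, h3, -⟩ := exists_columns_of_inversionTable_eq
    (S := fun c c' => Fits c (c.length + c'.length - 1) c')
    (fun hc hd' ht hS => by rw [← hc, ← hd']; exact hS.of_inversionTable_eq hc hd' ht)
    hq.1 hq.2.2 h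
  exact ⟨ribbonGlued cs, ⟨h2, rfl, h3⟩, h1⟩

lemma inversionTable_eq_of_mem_component {u v : List (Fin n)} (h : v ∈ component u) :
    inversionTable u = inversionTable v := by
  change Relation.EqvGen _ u v at h
  induction h with
  | rel _ _ h =>
    obtain ⟨i, h⟩ := h
    exact h.inversionTable_eq
  | refl => rfl
  | symm _ _ _ ih => exact ih.symm
  | trans _ _ _ _ _ ih ih' => exact ih.trans ih'

/-! ## The isomorphism of crystals -/

/-- The reading of the quasi-ribbon tableau of a word. -/
noncomputable def ribbonReading (w : List (Fin n)) : List (Fin n) :=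
  readSW (exists_quasiRibbon w).choose

lemma hypoEquiv_ribbonReading (w : List (Fin n)) : HypoEquiv w (ribbonReading w) :=
  (exists_quasiRibbon w).choose_spec.2

lemma ribbonReading_eq {w : List (Fin n)} {q : ColString n} (hq : q ∈ QuasiRibbon n)
    (h : HypoEquiv w (readSW q)) : ribbonReading w = readSW q := by
  rw [ribbonReading, quasiRibbon_ext (exists_quasiRibbon w).choose_spec.1 hq
    ((hypoEquiv_ribbonReading w).symm.trans h)]

/-- Equivalence provides an arrow from `ribbonReading u`. Its target is again the reading of a
quasi-ribbon tableau, by invariance of the table, and is equivalent to v, so it is `ribbonReading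
v`. -/
lemma Arrow.ribbonReading {i : ℕ} {u v : List (Fin n)} (h : Arrow i u v) :
    Arrow i (ribbonReading u) (ribbonReading v) := by
  obtain ⟨v', hv'⟩ := (hypoEquiv_ribbonReading u).exists_arrow h
  obtain ⟨q, hq, rfl⟩ := exists_quasiRibbon_of_inversionTable_eq
    (exists_quasiRibbon u).choose_spec.1 hv'.inversionTable_eq
  rwa [ribbonReading_eq hq ((hypoEquiv_ribbonReading u).arrow h hv')]

lemma ribbonReading_mem_component {u v : List (Fin n)} (h : v ∈ component u) :
    ribbonReading v ∈ component (ribbonReading u) := by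
  change Relation.EqvGen _ u v at h
  change Relation.EqvGen _ _ _
  induction h with
  | rel _ _ h =>
    obtain ⟨i, h⟩ := h
    exact .rel _ _ ⟨i, h.ribbonReading⟩
  | refl => exact .refl _
  | symm _ _ _ ih => exact .symm _ _ ih
  | trans _ _ _ _ _ ih ih' => exact .trans _ _ _ ih ih'

/-- Being in the image of the component is propagated along arrows in both directions, because
arrows into and out of `ribbonReading v` lift to arrows at v. -/
lemma exists_of_mem_component_ribbonReading {u y : List (Fin n)}
    (h : y ∈ component (ribbonReading u)) : ∃ v ∈ component u, ribbonReading v = y := by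
  have key : ∀ {a b : List (Fin n)}, Relation.EqvGen (fun a b => ∃ i, Arrow i a b) a b →
      ((∃ v ∈ component u, ribbonReading v = a) ↔ ∃ v ∈ component u, ribbonReading v = b) := by
    intro a b h
    induction h with
    | rel a b h =>
      obtain ⟨i, h⟩ := h
      constructor
      · rintro ⟨v, hv, rfl⟩
        obtain ⟨v', h'⟩ := (hypoEquiv_ribbonReading v).symm.exists_arrow h
        exact ⟨v', .trans _ _ _ hv (.rel _ _ ⟨i, h'⟩), h'.ribbonReading.right_unique h⟩
      · rintro ⟨v, hv, rfl⟩
        obtain ⟨v', h'⟩ := (hypoEquiv_ribbonReading v).symm.exists_arrow_to h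
        exact ⟨v', .trans _ _ _ hv (.symm _ _ (.rel _ _ ⟨i, h'⟩)), h'.ribbonReading.left_unique h⟩
    | refl => exact Iff.rfl
    | symm _ _ _ ih => exact ih.symm
    | trans _ _ _ _ _ ih ih' => exact ih.trans ih'
  exact (key h).1 ⟨u, .refl _, rfl⟩

/-- The table is constant on a component, and equal images have equal content. -/
lemma ribbonReading_injOn_component (u : List (Fin n)) :
    Set.InjOn ribbonReading (component u) := by
  intro v hv v' hv' h
  refine eq_of_inversionTable_eq ?_ ((inversionTable_eq_of_mem_component hv).symm.trans
    (inversionTable_eq_of_mem_component hv'))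
  exact ((hypoEquiv_ribbonReading v).1.trans (h ▸ List.Perm.refl _)).trans
    (hypoEquiv_ribbonReading v').1.symm

/-- Passing to the quasi-ribbon tableau is an isomorphism on every connected component. -/
lemma isCrystalIso_ribbonReading {u u' : List (Fin n)} (h : ribbonReading u = u') :
    IsCrystalIso fun v : component u =>
      (⟨ribbonReading v, h ▸ ribbonReading_mem_component v.2⟩ : component u') where
  bijective := by
    subst h
    refine ⟨fun v v' hv => Subtype.ext (ribbonReading_injOn_component u v.2 v'.2
      (congrArg Subtype.val hv)), fun y => ?_⟩
    obtain ⟨v, hv, hy⟩ := exists_of_mem_component_ribbonReading y.2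
    exact ⟨⟨v, hv⟩, Subtype.ext hy⟩
  wt_eq v := by
    funext x
    exact (hypoEquiv_ribbonReading _).1.symm.count_eq x
  arrow_iff i v v' := by
    refine ⟨Arrow.ribbonReading, fun ha => ?_⟩
    -- The arrow lifts to one from v to some w in the component, and injectivity identifies w with
    -- v'.
    obtain ⟨w, hw⟩ := (hypoEquiv_ribbonReading (v : List (Fin n))).symm.exists_arrow ha
    have h1 := hw.ribbonReading.right_unique ha
    have h2 : w ∈ component u := .trans _ _ _ v.2 (.rel _ _ ⟨i, hw⟩)
    rwa [ribbonReading_injOn_component u h2 v'.2 h1] at hw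

lemma emptyString_mem_young : (emptyString : ColString n) ∈ Young n :=
  ⟨by simp [emptyString], rfl, by simp [emptyString]⟩

lemma rba_emptyString : rba (emptyString : ColString n) = emptyString :=
  have h := rba_spec (young_subset_Scol (emptyString_mem_young (n := n)))
  quasiRibbon_ext h.1 emptyString_mem_quasiRibbon h.2.symm

end QuasiCrystal

/-! ### Assembly of the theorem -/

theorem mainTheorem9 (n : ℕ) (hn : 1 ≤ n) :
    -- every Young tableau has a unique normal form, so that `rba` is well defined
    (∀ d ∈ QuasiCrystal.Young n, ∃! q, QuasiCrystal.IsNormalFormOf d q) ∧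
    -- `rba` is a morphism of string data structures for the right and for the left insertions
    QuasiCrystal.IsSDSMorphism (QuasiCrystal.Young n) (QuasiCrystal.QuasiRibbon n)
      QuasiCrystal.insertSr QuasiCrystal.insertHr
      (QuasiCrystal.constructRight QuasiCrystal.insertHr) QuasiCrystal.rba ∧
    QuasiCrystal.IsSDSMorphism (QuasiCrystal.Young n) (QuasiCrystal.QuasiRibbon n)
      QuasiCrystal.insertSl QuasiCrystal.insertHl
      (QuasiCrystal.constructLeft QuasiCrystal.insertHl) QuasiCrystal.rba ∧
    -- it induces isomorphisms of connected components
    ∀ d ∈ QuasiCrystal.Young n,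
      (∀ v ∈ QuasiCrystal.component (QuasiCrystal.readSW d),
        ∃ d' ∈ QuasiCrystal.Young n, QuasiCrystal.readSW d' = v) ∧
      ∃ ψ : QuasiCrystal.component (QuasiCrystal.readSW d) →
          QuasiCrystal.component (QuasiCrystal.readSW (QuasiCrystal.rba d)),
        QuasiCrystal.IsCrystalIso ψ ∧
        ∀ v : QuasiCrystal.component (QuasiCrystal.readSW d), ∀ d' ∈ QuasiCrystal.Young n,
          QuasiCrystal.readSW d' = v → (ψ v : List (Fin n)) = QuasiCrystal.readSW (QuasiCrystal.rba d') := by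
  have hrba := fun d (hd : d ∈ QuasiCrystal.Young n) =>
    QuasiCrystal.rba_spec (QuasiCrystal.young_subset_Scol hd)
  refine ⟨fun d hd => QuasiCrystal.existsUnique_normalForm (QuasiCrystal.young_subset_Scol hd),
    ⟨fun d hd => (hrba d hd).1, QuasiCrystal.rba_emptyString, fun d hd x => ?_, fun d hd => ?_⟩,
    ⟨fun d hd => (hrba d hd).1, QuasiCrystal.rba_emptyString, fun d hd x => ?_, fun d hd => ?_⟩,
    fun d hd => ⟨fun v hv => ?_, _, QuasiCrystal.isCrystalIso_ribbonReading
      (QuasiCrystal.ribbonReading_eq (hrba d hd).1 (hrba d hd).2), ?_⟩⟩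
  -- Both sides are quasi-ribbon tableaux in the class of the reading of d followed by x. The other
  -- compatibilities with insertions and constructors are obtained in the same way.
  · have h1 := QuasiCrystal.insertSr_spec hd x
    have h2 := QuasiCrystal.insertHr_spec (hrba d hd).1 x
    have h3 := hrba _ h1.1
    exact QuasiCrystal.quasiRibbon_ext h3.1 h2.1 ((h3.2.symm.trans h1.2.symm).trans
      (((hrba d hd).2.append (QuasiCrystal.HypoEquiv.refl [x])).trans h2.2))
  · have h1 := QuasiCrystal.constructRight_spec (QuasiCrystal.readSW d)
    have h2 := QuasiCrystal.constructRight_spec (QuasiCrystal.readSW (QuasiCrystal.rba d))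
    exact QuasiCrystal.quasiRibbon_ext h1.1 h2.1
      ((h1.2.symm.trans (hrba d hd).2).trans h2.2)
  · have h1 := QuasiCrystal.insertSl_spec hd x
    have h2 := QuasiCrystal.insertHl_spec (hrba d hd).1 x
    have h3 := hrba _ h1.1
    exact QuasiCrystal.quasiRibbon_ext h3.1 h2.1 ((h3.2.symm.trans h1.2.symm).trans
      (((QuasiCrystal.HypoEquiv.refl [x]).append (hrba d hd).2).trans h2.2))
  · have h1 := QuasiCrystal.constructLeft_spec (QuasiCrystal.readSW d)
    have h2 := QuasiCrystal.constructLeft_spec (QuasiCrystal.readSW (QuasiCrystal.rba d))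
    exact QuasiCrystal.quasiRibbon_ext h1.1 h2.1
      ((h1.2.symm.trans (hrba d hd).2).trans h2.2)
  · exact QuasiCrystal.exists_young_of_inversionTable_eq hd
      (QuasiCrystal.inversionTable_eq_of_mem_component hv)
  · rintro v d' hd' hv
    exact QuasiCrystal.ribbonReading_eq (hrba d' hd').1 (hv ▸ (hrba d' hd').2)
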